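/- Let $I_1,I_2$ be independent random variables, $I_i$ having the mixture Exponential-Generalized Gamma density $$f_i(x)=\frac{\omega_i}{\lambda_i}e^{-x/\lambda_i}+(1-\omega_i)\frac{c_i x^{a_ic_i-1}}{b_i^{a_ic_i}\Gamma(a_i)}e^{-(x/b_i)^{c_i}},\qquad x>0,$$ with $0<\omega_i<1$ and $\lambda_i,a_i,b_i,c_i>0$. Let $r_1,r_2\in\{1,2\}$, let $C>0$ be a fixed constant, and for $\mu_1,\mu_2>0$ let $\gamma_i=\mu_i I_i^{r_i}$ be the SNR of hop $i$ and $\gamma=\gamma_1\gamma_2/(\gamma_2+C)$ the end-to-end SNR of the fixed-gain dual-hop link, with distribution function $F_\gamma$. For $n\ge1$, $\delta,p,q_1,\dots,q_n>0$ the average bit-error rate (BER) is $$P_e=\frac{\delta}{2\Gamma(p)}\sum_{k=1}^n\mathbb E[\Gamma(p,q_k\gamma)],\qquad \Gamma(p,x)=\int_x^\infty t^{p-1}e^{-t}\,dt .$$ Put $$B=\frac{\omega_1}{\lambda_1^{r_1a_2c_2/r_2}}\Gamma\Big(1-\frac{r_1a_2c_2}{r_2}\Big)+\frac{1-\omega_1}{\Gamma(a_1)\,b_1^{r_1a_2c_2/r_2}}\Gamma\Big(a_1-\frac{r_1a_2c_2}{c_1r_2}\Big),$$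 $$F^\infty(x)=\omega_1\Big(\frac{x}{\lambda_1^{r_1}\mu_1}\Big)^{\frac1{r_1}}+\frac{1-\omega_1}{\Gamma(a_1+1)}\Big(\frac{x}{b_1^{r_1}\mu_1}\Big)^{\frac{a_1c_1}{r_1}}+\frac{\omega_2(1-\omega_1)}{\Gamma(a_1)}\Gamma\Big(a_1-\frac{r_1}{c_1r_2}\Big)\Big(\frac{Cx}{b_1^{r_1}\lambda_2^{r_2}\mu_1\mu_2}\Big)^{\frac1{r_2}}+\frac{(1-\omega_2)B}{\Gamma(a_2+1)}\Big(\frac{Cx}{b_2^{r_2}\mu_1\mu_2}\Big)^{\frac{a_2c_2}{r_2}}$$ (the high-SNR expression of $F_\gamma$) and $$P_e^\infty=\frac{\delta\omega_1\Gamma(p+\frac1{r_1})}{2\Gamma(p)}\sum_{k=1}^n\Big(\frac{1}{q_k\lambda_1^{r_1}\mu_1}\Big)^{\frac1{r_1}}+\frac{\delta(1-\omega_1)\Gamma(p+\frac{a_1c_1}{r_1})}{2\Gamma(a_1+1)\Gamma(p)}\sum_{k=1}^n\Big(\frac{1}{q_kb_1^{r_1}\mu_1}\Big)^{\frac{a_1c_1}{r_1}}$$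 $$\quad+\frac{\delta\omega_2(1-\omega_1)\Gamma(a_1-\frac{r_1}{c_1r_2})\Gamma(p+\frac1{r_2})}{2\Gamma(a_1)\Gamma(p)}\sum_{k=1}^n\Big(\frac{C}{q_kb_1^{r_1}\lambda_2^{r_2}\mu_1\mu_2}\Big)^{\frac1{r_2}}+\frac{\delta(1-\omega_2)\Gamma(p+\frac{a_2c_2}{r_2})}{2\Gamma(a_2+1)\Gamma(p)}\,B\sum_{k=1}^n\Big(\frac{C}{q_kb_2^{r_2}\mu_1\mu_2}\Big)^{\frac{a_2c_2}{r_2}},$$ where a summand with the Gamma function at one of its poles is read as $0$. Then: 1. For all $\mu_1,\mu_2>0$, $\displaystyle P_e=\frac{\delta}{2\Gamma(p)}\sum_{k=1}^nq_k^p\int_0^\infty x^{p-1}e^{-q_kx}F_\gamma(x)\,dx.$ 2. For all $\mu_1,\mu_2>0$, substituting $F^\infty$ for $F_\gamma$ in this formula gives $n$ absolutely convergent integrals, and the value of the formula is then exactly $P_e^\infty$. 3. $P_e\sim P_e^\infty$ (the ratio tends to $1$) as $\mu_1,\mu_2\to\infty$ in any way such that, with $\alpha=\min(1,a_1c_1)/r_1$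 and $\beta=\min(1,a_2c_2)/r_2$: (i) if $\alpha=\beta$, then $\log\mu_1=o(\mu_2^{\alpha})$; (ii) if $a_2c_2\ge1$ and $1/r_2<\alpha$, then $(\mu_1\mu_2)^{-1/r_2}=o(\mu_1^{-\alpha})$. (For $\mu_1\asymp\mu_2$, (i) always holds, and (ii) holds unless $r_1=1$, $r_2=2$, $a_1c_1\ge1$ and $a_2c_2\ge1$; in every case both hold when $\mu_1=o(\mu_2)$.) -/

import Mathlib

open MeasureTheory ProbabilityTheory Set Filter Asymptotics

noncomputable section

namespace UWOC

/-- Parameters of a mixture Exponential-Generalized Gamma (EGG) distribution: `w` is the weight of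
the exponential component, `lam` its mean, and `a`, `b`, `c` are the parameters of the generalized
Gamma component. -/
structure EGG where
  w : ℝ
  lam : ℝ
  a : ℝ
  b : ℝ
  c : ℝ
  w_pos : 0 < w
  w_lt_one : w < 1
  lam_pos : 0 < lam
  a_pos : 0 < a
  b_pos : 0 < b
  c_pos : 0 < c

/-- The EGG probability density function at `x > 0`. -/
def EGG.pdf (H : EGG) (x : ℝ) : ℝ :=
  H.w / H.lam * Real.exp (-x / H.lam)
    + (1 - H.w) * (H.c * x ^ (H.a * H.c - 1) / (H.b ^ (H.a * H.c) * Real.Gamma H.a))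
      * Real.exp (-(x / H.b) ^ H.c)

/-- The EGG distribution: the law on `(0, ∞)` with density `EGG.pdf`. -/
def EGG.law (H : EGG) : Measure ℝ :=
  (volume.restrict (Ioi 0)).withDensity fun x => ENNReal.ofReal (H.pdf x)

/-- The diversity order `min (1 / r, a c / r)` of one hop: the smaller of the two exponents
of `x / μ` in the small-argument behaviour of the distribution function of `μ I ^ r`,
`I` having the EGG distribution. -/
def EGG.order (H : EGG) (r : ℕ) : ℝ :=
  min 1 (H.a * H.c) / r

/-- Instantaneous SNR of a hop with irradiance `x`, average electrical SNR `μ` and detection type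
`r` (`r = 1`: heterodyne, `r = 2`: IM/DD). -/
def hopSNR (μ : ℝ) (r : ℕ) (x : ℝ) : ℝ :=
  μ * x ^ r

/-- End-to-end SNR `γ₁ γ₂ / (γ₂ + C)` of the dual-hop link with a fixed gain relay, where `x₁` and
`x₂` are the irradiances of the two hops. -/
def endSNR (r₁ r₂ : ℕ) (C μ₁ μ₂ x₁ x₂ : ℝ) : ℝ :=
  hopSNR μ₁ r₁ x₁ * hopSNR μ₂ r₂ x₂ / (hopSNR μ₂ r₂ x₂ + C)

/-- Upper incomplete Gamma function `Γ(p, x)`, for `p > 0` and `x ≥ 0`. -/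
def upperGamma (p x : ℝ) : ℝ :=
  ∫ t in Ioi x, t ^ (p - 1) * Real.exp (-t)

/-- Parameters of a modulation scheme: the average BER with distribution of the SNR `γ` is
`δ / (2 Γ(p)) * ∑ k, E[Γ(p, q k * γ)]`. -/
structure Modulation where
  n : ℕ
  δ : ℝ
  p : ℝ
  q : Fin n → ℝ
  n_pos : 0 < n
  δ_pos : 0 < δ
  p_pos : 0 < p
  q_pos : ∀ k, 0 < q k

/-- The average BER when the SNR is the random variable `γ` on the probability space `(Ω, P)`. -/
def Modulation.avgBER (M : Modulation) {Ω : Type*} [MeasurableSpace Ω] (P : Measure Ω)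
    (γ : Ω → ℝ) : ℝ :=
  M.δ / (2 * Real.Gamma M.p) * ∑ k, ∫ o, upperGamma M.p (M.q k * γ o) ∂P

/-- The cumulative distribution function of the random variable `γ`. -/
def cdfOf {Ω : Type*} [MeasurableSpace Ω] (P : Measure Ω) (γ : Ω → ℝ) (x : ℝ) : ℝ :=
  P.real {o | γ o ≤ x}

/-- The form of the average BER obtained by integration by parts, as a functional of a function `F`
in the place of the cumulative distribution function of the SNR. -/
def Modulation.berOfCDF (M : Modulation) (F : ℝ → ℝ) : ℝ :=
  M.δ / (2 * Real.Gamma M.p)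
    * ∑ k, M.q k ^ M.p * ∫ x in Ioi 0, x ^ (M.p - 1) * Real.exp (-(M.q k * x)) * F x

/-- The high-SNR expression of the cumulative distribution function of the end-to-end SNR.
A summand in which the Gamma function has a pole is read as zero (`Real.Gamma (-m) = 0`). -/
def cdfHighSNR (H₁ H₂ : EGG) (r₁ r₂ : ℕ) (C μ₁ μ₂ x : ℝ) : ℝ :=
  H₁.w * (x / (H₁.lam ^ r₁ * μ₁)) ^ (1 / r₁ : ℝ)
  + (1 - H₁.w) / Real.Gamma (H₁.a + 1) * (x / (H₁.b ^ r₁ * μ₁)) ^ (H₁.a * H₁.c / r₁)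
  + H₂.w * (1 - H₁.w) / Real.Gamma H₁.a * Real.Gamma (H₁.a - r₁ / (H₁.c * r₂))
      * (C * x / (H₁.b ^ r₁ * H₂.lam ^ r₂ * μ₁ * μ₂)) ^ (1 / r₂ : ℝ)
  + (1 - H₂.w) / Real.Gamma (H₂.a + 1)
      * (C * x / (H₂.b ^ r₂ * μ₁ * μ₂)) ^ (H₂.a * H₂.c / r₂)
      * (H₁.w / H₁.lam ^ (r₁ * H₂.a * H₂.c / r₂) * Real.Gamma (1 - r₁ * H₂.a * H₂.c / r₂)
        + (1 - H₁.w) / (Real.Gamma H₁.a * H₁.b ^ (r₁ * H₂.a * H₂.c / r₂))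
          * Real.Gamma (H₁.a - r₁ * H₂.a * H₂.c / (H₁.c * r₂)))

/-- The high-SNR expression of the average BER, with the same convention at the poles of the
Gamma function. -/
def Modulation.berHighSNR (M : Modulation) (H₁ H₂ : EGG) (r₁ r₂ : ℕ) (C μ₁ μ₂ : ℝ) : ℝ :=
  M.δ * H₁.w * Real.Gamma (M.p + 1 / r₁) / (2 * Real.Gamma M.p)
      * ∑ k, (1 / (M.q k * H₁.lam ^ r₁ * μ₁)) ^ (1 / r₁ : ℝ)
  + M.δ * (1 - H₁.w) * Real.Gamma (M.p + H₁.a * H₁.c / r₁)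
        / (2 * Real.Gamma (H₁.a + 1) * Real.Gamma M.p)
      * ∑ k, (1 / (M.q k * H₁.b ^ r₁ * μ₁)) ^ (H₁.a * H₁.c / r₁)
  + M.δ * H₂.w * (1 - H₁.w) * Real.Gamma (H₁.a - r₁ / (H₁.c * r₂)) * Real.Gamma (M.p + 1 / r₂)
        / (2 * Real.Gamma H₁.a * Real.Gamma M.p)
      * ∑ k, (C / (M.q k * H₁.b ^ r₁ * H₂.lam ^ r₂ * μ₁ * μ₂)) ^ (1 / r₂ : ℝ)
  + M.δ * (1 - H₂.w) * Real.Gamma (M.p + H₂.a * H₂.c / r₂)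
        / (2 * Real.Gamma (H₂.a + 1) * Real.Gamma M.p)
      * (H₁.w / H₁.lam ^ (r₁ * H₂.a * H₂.c / r₂) * Real.Gamma (1 - r₁ * H₂.a * H₂.c / r₂)
        + (1 - H₁.w) / (Real.Gamma H₁.a * H₁.b ^ (r₁ * H₂.a * H₂.c / r₂))
          * Real.Gamma (H₁.a - r₁ * H₂.a * H₂.c / (H₁.c * r₂)))
      * ∑ k, (C / (M.q k * H₂.b ^ r₂ * μ₁ * μ₂)) ^ (H₂.a * H₂.c / r₂)

end UWOC

end

/-!
Up to the factor `Γ(p)`, the `k`-th integral of `berOfCDF` is the mean of `F` under the Gamma law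
with shape `p` and rate `q k`. Hence for independent `U` with this law the `k`-th term of the
average BER is `(δ / 2) P(γ ≤ U)`, and the expected BER expression is the same linear functional of
`F^∞`.

With `X = I₁ ^ r₁` and `Y = I₂ ^ r₂`, the event `γ ≤ U` is `X ≤ v + w` for `v = U / μ₁` and
`w = (U / μ₁) C / (μ₂ Y)`. The distribution function `G` of `X` is `α`-Hölder with `G(s) ∼ κ s ^ α`,
so `|G(v + w) - G(v) - G(w)|` is at most a multiple of `min(v, w) ^ α`, and the probability splits
into `P(X ≤ U / μ₁) ∼ κ E[U ^ α] μ₁ ^ (-α)` and `P(X Y ≤ C U / (μ₁ μ₂))`. For `β < α` the latter is,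
by conditioning on `X` instead of `Y`, equivalent to a multiple of `(μ₁ μ₂) ^ (-β)`. For `β ≥ α` it
is `o(μ₁ ^ (-α))`: from `P(X Y ≤ s) ≤ D s ^ ρ E[Y ^ (-ρ)]` and `E[Y ^ (-ρ)] ≤ D / (β - ρ)` one gets
a bound by `s ^ α` with `ρ = α` if `α < β`, and a bound by `s ^ α |log s|` with
`ρ = α - 1 / |log s|` if `α = β`.
-/

noncomputable section

namespace UWOC

open scoped Topology

/-! ### Power asymptotics at the origin -/

section Asymptotics

variable {ι : Type*} {l : Filter ι}

lemma isEquivalent_add_of_nonneg {u₁ u₂ v₁ v₂ : ι → ℝ} (h₁ : u₁ ~[l] v₁) (h₂ : u₂ ~[l] v₂)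
    (hv₁ : ∀ᶠ i in l, 0 ≤ v₁ i) (hv₂ : ∀ᶠ i in l, 0 ≤ v₂ i) :
    (fun i => u₁ i + u₂ i) ~[l] fun i => v₁ i + v₂ i := by
  refine (h₁.isLittleO.add_add h₂.isLittleO).congr' (.of_forall fun i => ?_) ?_
  · simp only [Pi.sub_apply]
    ring
  · filter_upwards [hv₁, hv₂] with i h h'
    rw [Real.norm_of_nonneg h, Real.norm_of_nonneg h']

lemma isEquivalent_sum_of_nonneg {K : Type*} {S : Finset K} {u v : K → ι → ℝ}
    (huv : ∀ k ∈ S, u k ~[l] v k) (hv : ∀ k ∈ S, ∀ᶠ i in l, 0 ≤ v k i) :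
    (fun i => ∑ k ∈ S, u k i) ~[l] fun i => ∑ k ∈ S, v k i := by
  have hsum := IsLittleO.sum_congr huv
  refine (hsum.congr' (.of_forall fun i => ?_) ?_)
  · simp [Finset.sum_sub_distrib]
  · filter_upwards [(Finset.eventually_all S).mpr hv] with i hi
    exact Finset.sum_congr rfl fun k hk => Real.norm_of_nonneg (hi k hk)

lemma isEquivalent_const_mul_rpow_of_tendsto_div {g : ℝ → ℝ} {a κ : ℝ} (hκ : κ ≠ 0)
    (hg : Tendsto (fun s => g s / s ^ a) (𝓝[>] 0) (𝓝 κ)) :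
    g ~[𝓝[>] 0] fun s => κ * s ^ a := by
  have hpos : ∀ᶠ s : ℝ in 𝓝[>] 0, s ^ a ≠ 0 := by
    filter_upwards [self_mem_nhdsWithin] with s hs using (Real.rpow_pos_of_pos hs a).ne'
  refine (((isEquivalent_const_iff_tendsto hκ).mpr hg).mul
    (IsEquivalent.refl (u := fun s : ℝ => s ^ a))).congr_left ?_
  filter_upwards [hpos] with s hs using div_mul_cancel₀ _ hs

lemma isLittleO_rpow_rpow_nhdsGT_zero {a e : ℝ} (h : a < e) :
    (fun s : ℝ => s ^ e) =o[𝓝[>] 0] fun s => s ^ a := by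
  have hpos : ∀ᶠ s : ℝ in 𝓝[>] 0, 0 < s := self_mem_nhdsWithin
  rw [isLittleO_iff_tendsto' (hpos.mono fun s hs h0 => absurd h0 (Real.rpow_pos_of_pos hs a).ne')]
  have hlim : Tendsto (fun s : ℝ => s ^ (e - a)) (𝓝[>] 0) (𝓝 0) := by
    simpa [Real.zero_rpow (sub_pos.mpr h).ne'] using
      ((Real.continuousAt_rpow_const 0 (e - a) (.inr (sub_pos.mpr h).le)).tendsto.mono_left
        nhdsWithin_le_nhds)
  refine hlim.congr' ?_
  filter_upwards [hpos] with s hs using Real.rpow_sub hs e a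

lemma isBigO_rpow_rpow_nhdsGT_zero {a e : ℝ} (h : a ≤ e) :
    (fun s : ℝ => s ^ e) =O[𝓝[>] 0] fun s => s ^ a := by
  rcases h.eq_or_lt with rfl | hlt
  · exact isBigO_refl _ _
  · exact (isLittleO_rpow_rpow_nhdsGT_zero hlt).isBigO

lemma tendsto_mul_nhdsGT_zero {s t : ι → ℝ} (hs : Tendsto s l (𝓝[>] 0))
    (ht : Tendsto t l (𝓝[>] 0)) : Tendsto (fun i => s i * t i) l (𝓝[>] 0) := by
  refine tendsto_nhdsWithin_iff.mpr ⟨?_, ?_⟩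
  · simpa using (tendsto_nhds_of_tendsto_nhdsWithin hs).mul (tendsto_nhds_of_tendsto_nhdsWithin ht)
  · filter_upwards [hs.eventually self_mem_nhdsWithin, ht.eventually self_mem_nhdsWithin]
      with i hsi hti using mul_pos hsi hti

lemma isLittleO_mul_rpow {s t : ι → ℝ} {a e : ℝ} (he : 0 < e) (hae : a ≤ e)
    (hs : Tendsto s l (𝓝[>] 0)) (ht : Tendsto t l (𝓝[>] 0)) :
    (fun i => (s i * t i) ^ e) =o[l] fun i => s i ^ a := by
  have hs' : (fun i => s i ^ e) =O[l] fun i => s i ^ a :=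
    (isBigO_rpow_rpow_nhdsGT_zero hae).comp_tendsto hs
  have ht' : (fun i => t i ^ e) =o[l] fun _ => (1 : ℝ) := by
    simpa only [Function.comp_def, Real.rpow_zero] using
      (isLittleO_rpow_rpow_nhdsGT_zero he).comp_tendsto ht
  refine (hs'.mul_isLittleO ht').congr' ?_ (.of_forall fun i => mul_one _)
  filter_upwards [hs.eventually self_mem_nhdsWithin, ht.eventually self_mem_nhdsWithin]
    with i hsi hti using (Real.mul_rpow (le_of_lt hsi) (le_of_lt hti)).symm

end Asymptotics

section Scaling

variable {X : Type*} [MeasurableSpace X] {ν : Measure X} {V : X → ℝ} {G : ℝ → ℝ} {a D κ : ℝ}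

lemma tendsto_mul_const_nhdsGT_zero {v : ℝ} (hv : 0 < v) :
    Tendsto (fun s : ℝ => s * v) (𝓝[>] 0) (𝓝[>] 0) := by
  refine tendsto_nhdsWithin_iff.mpr ⟨?_, ?_⟩
  · simpa using (tendsto_id.mul_const v : Tendsto _ (𝓝 (0 : ℝ)) _).mono_left nhdsWithin_le_nhds
  · filter_upwards [self_mem_nhdsWithin] with s hs using mul_pos hs hv

/- Dominated convergence: `G (s v) / s ^ a = v ^ a * (G (s v) / (s v) ^ a)`. -/
lemma tendsto_integral_comp_mul_div_rpow (hG : Measurable G) (hV : AEMeasurable V ν)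
    (hpos : ∀ᵐ x ∂ν, 0 < V x) (hbound : ∀ s, 0 < s → |G s| ≤ D * s ^ a)
    (hlim : Tendsto (fun s => G s / s ^ a) (𝓝[>] 0) (𝓝 κ))
    (hint : Integrable (fun x => V x ^ a) ν) :
    Tendsto (fun s => (∫ x, G (s * V x) ∂ν) / s ^ a) (𝓝[>] 0) (𝓝 (κ * ∫ x, V x ^ a ∂ν)) := by
  simp_rw [← integral_div, ← integral_const_mul κ]
  refine tendsto_integral_filter_of_dominated_convergence (fun x => D * V x ^ a)
    (.of_forall fun s =>
      ((hG.comp_aemeasurable (hV.const_mul s)).div_const _).aestronglyMeasurable)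
    ?_ (hint.const_mul D) ?_
  · filter_upwards [self_mem_nhdsWithin] with s (hs : 0 < s)
    filter_upwards [hpos] with x hx
    rw [norm_div, Real.norm_eq_abs, Real.norm_of_nonneg (by positivity),
      div_le_iff₀ (by positivity), mul_assoc, mul_comm (V x ^ a), ← Real.mul_rpow hs.le hx.le]
    exact hbound _ (mul_pos hs hx)
  · filter_upwards [hpos] with x hx
    refine ((hlim.comp (tendsto_mul_const_nhdsGT_zero hx)).mul_const (V x ^ a)).congr' ?_
    filter_upwards [self_mem_nhdsWithin] with s (hs : 0 < s)
    have hsa := (Real.rpow_pos_of_pos hs a).ne'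
    have hxa := (Real.rpow_pos_of_pos hx a).ne'
    rw [Function.comp_apply, Real.mul_rpow hs.le hx.le]
    field_simp

lemma integral_comp_mul_le (hG0 : ∀ s, 0 ≤ G s) (hpos : ∀ᵐ x ∂ν, 0 < V x)
    (hbound : ∀ s, 0 < s → G s ≤ D * s ^ a) (hint : Integrable (fun x => V x ^ a) ν)
    {s : ℝ} (hs : 0 < s) :
    ∫ x, G (s * V x) ∂ν ≤ D * s ^ a * ∫ x, V x ^ a ∂ν := by
  rw [← integral_const_mul]
  refine integral_mono_of_nonneg (.of_forall fun x => hG0 _) (hint.const_mul _) ?_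
  filter_upwards [hpos] with x hx
  simpa only [Real.mul_rpow hs.le hx.le, mul_assoc] using hbound _ (mul_pos hs hx)

/- The substitution `x = s v` turns the distribution function into an average over `v ∈ (0, 1)`. -/
lemma tendsto_setIntegral_Ioc_div_rpow {f : ℝ → ℝ} (hf : Measurable f) (ha : 0 < a)
    (hbound : ∀ s, 0 < s → |f s| ≤ D * s ^ (a - 1))
    (hlim : Tendsto (fun s => f s / s ^ (a - 1)) (𝓝[>] 0) (𝓝 κ)) :
    Tendsto (fun s => (∫ x in Ioc 0 s, f x) / s ^ a) (𝓝[>] 0) (𝓝 (κ / a)) := by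
  have hint : IntervalIntegrable (fun v : ℝ => v ^ (a - 1)) volume 0 1 :=
    intervalIntegral.intervalIntegrable_rpow' (by linarith)
  have hmean := tendsto_integral_comp_mul_div_rpow (ν := volume.restrict (Ioc 0 1)) hf
    aemeasurable_id ((ae_restrict_mem measurableSet_Ioc).mono fun v hv => hv.1) hbound hlim
    ((intervalIntegrable_iff_integrableOn_Ioc_of_le zero_le_one).mp hint)
  have hval : ∫ v in Ioc (0 : ℝ) 1, v ^ (a - 1) = a⁻¹ := by
    rw [← intervalIntegral.integral_of_le zero_le_one, integral_rpow (.inl (by linarith))]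
    simp [Real.zero_rpow ha.ne']
  simp only [id, hval] at hmean
  refine hmean.congr' ?_
  filter_upwards [self_mem_nhdsWithin] with s (hs : 0 < s)
  have hsubst : ∫ v in Ioc (0 : ℝ) 1, f (s * v) = s⁻¹ * ∫ x in Ioc 0 s, f x := by
    rw [← intervalIntegral.integral_of_le zero_le_one, ← intervalIntegral.integral_of_le hs.le,
      intervalIntegral.integral_comp_mul_left _ hs.ne']
    simp
  have hsa := (Real.rpow_pos_of_pos hs a).ne'
  rw [hsubst, Real.rpow_sub_one hs.ne']
  field_simp

end Scaling

/-! ### Laws with a power behaviour at the origin -/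

/-- A law on `(0, ∞)` of order `α` at the origin: its distribution function is `α`-Hölder and
equivalent to `κ s ^ α` as `s → 0+`. This is all that the diversity analysis uses about a hop. -/
structure IsPowerLawAtZero (ν : Measure ℝ) (α κ : ℝ) : Prop where
  exponent_pos : 0 < α
  coeff_pos : 0 < κ
  ae_pos : ∀ᵐ x ∂ν, 0 < x
  exists_cdf_sub_le : ∃ D : ℝ, ∀ s t, 0 ≤ s → s ≤ t → cdf ν t - cdf ν s ≤ D * (t - s) ^ α
  tendsto_cdf_div : Tendsto (fun s => cdf ν s / s ^ α) (𝓝[>] 0) (𝓝 κ)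

lemma measurable_cdf (ν : Measure ℝ) : Measurable (cdf ν) := (monotone_cdf ν).measurable

lemma norm_cdf_le_one (ν : Measure ℝ) (x : ℝ) : ‖cdf ν x‖ ≤ 1 := by
  rw [Real.norm_of_nonneg (cdf_nonneg ν x)]
  exact cdf_le_one ν x

lemma integrable_cdf_comp {X : Type*} [MeasurableSpace X] {P : Measure X} [IsFiniteMeasure P]
    (ν : Measure ℝ) {f : X → ℝ} (hf : Measurable f) : Integrable (fun x => cdf ν (f x)) P :=
  .of_bound ((measurable_cdf ν).comp hf).aestronglyMeasurable 1
    (.of_forall fun _ => norm_cdf_le_one ν _)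

lemma cdf_zero_of_ae_pos {ν : Measure ℝ} [IsProbabilityMeasure ν] (hν : ∀ᵐ x ∂ν, 0 < x) :
    cdf ν 0 = 0 := by
  rw [cdf_eq_real, measureReal_def, measure_eq_zero_iff_ae_notMem.mpr]
  · rfl
  · filter_upwards [hν] with x hx using not_le.mpr hx

section Construction

variable {ν : Measure ℝ} {f : ℝ → ℝ} {a D κ : ℝ}

lemma ae_pos_of_eq_withDensity
    (hν : ν = (volume.restrict (Ioi 0)).withDensity fun x => ENNReal.ofReal (f x)) :
    ∀ᵐ x ∂ν, 0 < x :=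
  hν ▸ withDensity_absolutelyContinuous _ _ (ae_restrict_mem measurableSet_Ioi)

lemma integral_of_eq_withDensity
    (hν : ν = (volume.restrict (Ioi 0)).withDensity fun x => ENNReal.ofReal (f x))
    (hf : Measurable f) (hf0 : ∀ x, 0 < x → 0 ≤ f x) (g : ℝ → ℝ) :
    ∫ x, g x ∂ν = ∫ x in Ioi 0, f x * g x := by
  rw [hν, integral_withDensity_eq_integral_toReal_smul hf.ennreal_ofReal
    (.of_forall fun _ => ENNReal.ofReal_lt_top)]
  refine setIntegral_congr_fun measurableSet_Ioi fun x hx => ?_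
  simp only [ENNReal.toReal_ofReal (hf0 x hx), smul_eq_mul]

lemma integrable_iff_of_eq_withDensity
    (hν : ν = (volume.restrict (Ioi 0)).withDensity fun x => ENNReal.ofReal (f x))
    (hf : Measurable f) (hf0 : ∀ x, 0 < x → 0 ≤ f x) (g : ℝ → ℝ) :
    Integrable g ν ↔ IntegrableOn (fun x => f x * g x) (Ioi 0) := by
  rw [hν, integrable_withDensity_iff_integrable_smul' hf.ennreal_ofReal
    (.of_forall fun _ => ENNReal.ofReal_lt_top)]
  refine integrableOn_congr_fun (fun x hx => ?_) measurableSet_Ioi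
  simp only [ENNReal.toReal_ofReal (hf0 x hx), smul_eq_mul]

lemma cdf_sub_cdf_eq_setIntegral [IsProbabilityMeasure ν]
    (hν : ν = (volume.restrict (Ioi 0)).withDensity fun x => ENNReal.ofReal (f x))
    (hf : Measurable f) (hf0 : ∀ x, 0 < x → 0 ≤ f x) {s t : ℝ} (hs : 0 ≤ s) (hst : s ≤ t) :
    cdf ν t - cdf ν s = ∫ x in Ioc s t, f x := by
  have hpos : Ioc s t ∩ Ioi 0 = Ioc s t := inter_eq_left.mpr fun x hx => hs.trans_lt hx.1
  have hIoc : ν (Ioc s t) = ENNReal.ofReal (cdf ν t - cdf ν s) := by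
    conv_lhs => rw [← measure_cdf ν]
    exact (cdf ν).measure_Ioc s t
  rw [integral_eq_lintegral_of_nonneg_ae
      ((ae_restrict_mem measurableSet_Ioc).mono fun x hx => hf0 x (hs.trans_lt hx.1))
      hf.aestronglyMeasurable, ← ENNReal.toReal_ofReal (sub_nonneg.mpr (monotone_cdf ν hst)),
    ← hIoc, hν, withDensity_apply _ measurableSet_Ioc,
    Measure.restrict_restrict measurableSet_Ioc, hpos]

lemma setIntegral_Ioc_le_of_le_rpow (ha : 0 < a) (hf0 : ∀ x, 0 < x → 0 ≤ f x)
    (hbound : ∀ x, 0 < x → f x ≤ D * x ^ (a - 1)) {s t : ℝ} (hs : 0 ≤ s) (hst : s ≤ t) :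
    ∫ x in Ioc s t, f x ≤ D / a * (t ^ a - s ^ a) := by
  have hint : IntegrableOn (fun x : ℝ => D * x ^ (a - 1)) (Ioc s t) :=
    ((intervalIntegrable_iff_integrableOn_Ioc_of_le hst).mp
      (intervalIntegral.intervalIntegrable_rpow' (by linarith))).const_mul D
  have hpos : ∀ᵐ x ∂volume.restrict (Ioc s t), 0 < x :=
    (ae_restrict_mem measurableSet_Ioc).mono fun x hx => hs.trans_lt hx.1
  calc ∫ x in Ioc s t, f x ≤ ∫ x in Ioc s t, D * x ^ (a - 1) :=
        integral_mono_of_nonneg (hpos.mono hf0) hint (hpos.mono hbound)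
    _ = D / a * (t ^ a - s ^ a) := by
        rw [integral_const_mul, ← intervalIntegral.integral_of_le hst,
          integral_rpow (.inl (by linarith)), sub_add_cancel]
        ring

lemma rpow_sub_rpow_le {s t : ℝ} (ha : 0 ≤ a) (ha1 : a ≤ 1) (hs : 0 ≤ s) (hst : s ≤ t) :
    t ^ a - s ^ a ≤ (t - s) ^ a := by
  have h := Real.rpow_add_le_add_rpow hs (sub_nonneg.mpr hst) ha ha1
  rw [add_sub_cancel] at h
  linarith

theorem IsPowerLawAtZero.of_density [IsProbabilityMeasure ν]
    (hν : ν = (volume.restrict (Ioi 0)).withDensity fun x => ENNReal.ofReal (f x))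
    (ha : 0 < a) (ha1 : a ≤ 1) (hκ : 0 < κ) (hf : Measurable f) (hf0 : ∀ x, 0 < x → 0 ≤ f x)
    (hbound : ∀ x, 0 < x → f x ≤ D * x ^ (a - 1))
    (hlim : Tendsto (fun s => f s / s ^ (a - 1)) (𝓝[>] 0) (𝓝 (a * κ))) :
    IsPowerLawAtZero ν a κ where
  exponent_pos := ha
  coeff_pos := hκ
  ae_pos := ae_pos_of_eq_withDensity hν
  exists_cdf_sub_le := by
    refine ⟨D / a, fun s t hs hst => ?_⟩
    have hD : 0 ≤ D := by simpa using (hf0 1 one_pos).trans (hbound 1 one_pos)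
    rw [cdf_sub_cdf_eq_setIntegral hν hf hf0 hs hst]
    exact (setIntegral_Ioc_le_of_le_rpow ha hf0 hbound hs hst).trans
      (mul_le_mul_of_nonneg_left (rpow_sub_rpow_le ha.le ha1 hs hst) (by positivity))
  tendsto_cdf_div := by
    have h := tendsto_setIntegral_Ioc_div_rpow hf ha (fun s hs => by
      rw [abs_of_nonneg (hf0 s hs)]; exact hbound s hs) hlim
    rw [mul_div_cancel_left₀ _ ha.ne'] at h
    refine h.congr' ?_
    filter_upwards [self_mem_nhdsWithin] with s (hs : 0 < s)
    rw [← cdf_sub_cdf_eq_setIntegral hν hf hf0 le_rfl hs.le,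
      cdf_zero_of_ae_pos (ae_pos_of_eq_withDensity hν), sub_zero]

lemma cdf_map_pow [IsProbabilityMeasure ν] (hν : ∀ᵐ x ∂ν, 0 < x) {r : ℕ} (hr : r ≠ 0) {s : ℝ}
    (hs : 0 ≤ s) : cdf (ν.map (· ^ r)) s = cdf ν (s ^ (r : ℝ)⁻¹) := by
  have : IsProbabilityMeasure (ν.map (· ^ r)) := Measure.isProbabilityMeasure_map (by fun_prop)
  rw [cdf_eq_real, cdf_eq_real, map_measureReal_apply (by fun_prop) measurableSet_Iic]
  refine measureReal_congr ?_
  filter_upwards [hν] with x hx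
  have hroot : x ≤ s ^ (r : ℝ)⁻¹ ↔ x ^ r ≤ s := by
    rw [Real.le_rpow_inv_iff_of_pos hx.le hs (by positivity), Real.rpow_natCast]
  exact propext hroot.symm

theorem IsPowerLawAtZero.map_pow [IsProbabilityMeasure ν] (hν : IsPowerLawAtZero ν a κ) {r : ℕ}
    (hr : r ≠ 0) : IsPowerLawAtZero (ν.map (· ^ r)) (a / r) κ where
  exponent_pos := div_pos hν.exponent_pos (by positivity)
  coeff_pos := hν.coeff_pos
  ae_pos := (ae_map_iff (by fun_prop) measurableSet_Ioi).mpr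
    (hν.ae_pos.mono fun x hx => pow_pos hx r)
  exists_cdf_sub_le := by
    obtain ⟨D, hD⟩ := hν.exists_cdf_sub_le
    have hD0 : 0 ≤ D := by
      simpa using (sub_nonneg.mpr (monotone_cdf ν zero_le_one)).trans (hD 0 1 le_rfl zero_le_one)
    refine ⟨D, fun s t hs hst => ?_⟩
    have hroot : s ^ (r : ℝ)⁻¹ ≤ t ^ (r : ℝ)⁻¹ := Real.rpow_le_rpow hs hst (by positivity)
    rw [cdf_map_pow hν.ae_pos hr hs, cdf_map_pow hν.ae_pos hr (hs.trans hst)]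
    calc cdf ν (t ^ (r : ℝ)⁻¹) - cdf ν (s ^ (r : ℝ)⁻¹)
        ≤ D * (t ^ (r : ℝ)⁻¹ - s ^ (r : ℝ)⁻¹) ^ a := hD _ _ (by positivity) hroot
      _ ≤ D * ((t - s) ^ (r : ℝ)⁻¹) ^ a := by
          refine mul_le_mul_of_nonneg_left (Real.rpow_le_rpow (sub_nonneg.mpr hroot)
            (rpow_sub_rpow_le (by positivity) (Nat.cast_inv_le_one r) hs hst)
            hν.exponent_pos.le) hD0
      _ = D * (t - s) ^ (a / r) := by
          rw [← Real.rpow_mul (sub_nonneg.mpr hst), inv_mul_eq_div]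
  tendsto_cdf_div := by
    have hroot : Tendsto (fun s : ℝ => s ^ (r : ℝ)⁻¹) (𝓝[>] 0) (𝓝[>] 0) := by
      refine tendsto_nhdsWithin_iff.mpr ⟨?_, ?_⟩
      · have hcont := Real.continuousAt_rpow_const 0 (r : ℝ)⁻¹ (.inr (by positivity))
        simpa [ContinuousAt, Real.zero_rpow (by positivity : (r : ℝ)⁻¹ ≠ 0)] using
          hcont.tendsto.mono_left nhdsWithin_le_nhds
      · filter_upwards [self_mem_nhdsWithin] with s hs using Real.rpow_pos_of_pos hs _
    refine (hν.tendsto_cdf_div.comp hroot).congr' ?_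
    filter_upwards [self_mem_nhdsWithin] with s (hs : 0 < s)
    rw [Function.comp_apply, cdf_map_pow hν.ae_pos hr hs.le, ← Real.rpow_mul hs.le, inv_mul_eq_div]

end Construction

/-! ### Negative moments -/

lemma lintegral_Ioc_ofReal_rpow {ρ : ℝ} (hρ : 0 < ρ) :
    ∫⁻ t in Ioc 0 1, ENNReal.ofReal (t ^ (ρ - 1)) = ENNReal.ofReal (1 / ρ) := by
  have hint := (intervalIntegrable_iff_integrableOn_Ioc_of_le zero_le_one).mp
    (intervalIntegral.intervalIntegrable_rpow' (a := 0) (b := 1) (by linarith : -1 < ρ - 1))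
  rw [← ofReal_integral_eq_lintegral_ofReal hint ((ae_restrict_mem measurableSet_Ioc).mono
    fun t ht => Real.rpow_nonneg ht.1.le _), ← intervalIntegral.integral_of_le zero_le_one,
    integral_rpow (.inl (by linarith))]
  simp [Real.zero_rpow hρ.ne']

lemma lintegral_Ioi_ofReal_mul_rpow {D σ : ℝ} (hD : 0 ≤ D) (hσ : 0 < σ) :
    ∫⁻ t in Ioi 1, ENNReal.ofReal (D * t ^ (-σ - 1)) = ENNReal.ofReal (D / σ) := by
  have hint : IntegrableOn (fun t : ℝ => D * t ^ (-σ - 1)) (Ioi 1) :=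
    (integrableOn_Ioi_rpow_of_lt (by linarith) one_pos).const_mul D
  rw [← ofReal_integral_eq_lintegral_ofReal hint ((ae_restrict_mem measurableSet_Ioi).mono
    fun t (ht : 1 < t) => by positivity), integral_const_mul,
    integral_Ioi_rpow_of_lt (by linarith) one_pos, sub_add_cancel, Real.one_rpow,
    neg_div_neg_eq, mul_one_div]

lemma integral_rpow_pos {ν : Measure ℝ} [NeZero ν] (hν : ∀ᵐ x ∂ν, 0 < x) {ρ : ℝ}
    (hint : Integrable (fun x => x ^ ρ) ν) : 0 < ∫ x, x ^ ρ ∂ν := by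
  refine (integral_pos_iff_support_of_nonneg_ae
    (hν.mono fun x hx => Real.rpow_nonneg hx.le _) hint).mpr ?_
  have hsupp : Function.support (fun x : ℝ => x ^ ρ) =ᵐ[ν] univ :=
    eventuallyEq_univ.mpr (hν.mono fun x hx => (Real.rpow_pos_of_pos hx _).ne')
  rw [measure_congr hsupp]
  exact Measure.measure_univ_pos.mpr (NeZero.ne ν)

namespace IsPowerLawAtZero

variable {ν : Measure ℝ} [IsProbabilityMeasure ν] {α κ : ℝ}

lemma exists_cdf_le (hν : IsPowerLawAtZero ν α κ) :
    ∃ D : ℝ, 0 < D ∧ ∀ ρ s, 0 ≤ ρ → ρ ≤ α → 0 < s → cdf ν s ≤ D * s ^ ρ := by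
  obtain ⟨D, hD⟩ := hν.exists_cdf_sub_le
  refine ⟨max D 1, by positivity, fun ρ s hρ hρα hs => ?_⟩
  rcases le_total s 1 with hs1 | hs1
  · have h := hD 0 s le_rfl hs.le
    rw [cdf_zero_of_ae_pos hν.ae_pos, sub_zero, sub_zero] at h
    calc cdf ν s ≤ D * s ^ α := h
      _ ≤ max D 1 * s ^ ρ := mul_le_mul (le_max_left _ _)
          (Real.rpow_le_rpow_of_exponent_ge hs hs1 hρα) (by positivity) (by positivity)
  · calc cdf ν s ≤ 1 * 1 := by simpa using cdf_le_one ν s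
      _ ≤ max D 1 * s ^ ρ := mul_le_mul (le_max_right _ _) (Real.one_le_rpow hs1 hρ)
          zero_le_one (by positivity)

lemma exists_abs_cdf_add_sub_le (hν : IsPowerLawAtZero ν α κ) :
    ∃ D : ℝ, ∀ u v, 0 ≤ u → 0 ≤ v →
      |cdf ν (u + v) - cdf ν u - cdf ν v| ≤ D * min u v ^ α := by
  obtain ⟨D, hD⟩ := hν.exists_cdf_sub_le
  have key : ∀ u v, 0 ≤ u → u ≤ v → |cdf ν (u + v) - cdf ν u - cdf ν v| ≤ D * u ^ α := by
    intro u v hu huv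
    have hmono : cdf ν v ≤ cdf ν (u + v) := monotone_cdf ν (by linarith)
    have hincr := hD v (u + v) (hu.trans huv) (by linarith)
    have hu' := hD 0 u le_rfl hu
    have hnonneg := cdf_nonneg ν u
    rw [add_sub_cancel_right] at hincr
    rw [cdf_zero_of_ae_pos hν.ae_pos, sub_zero, sub_zero] at hu'
    rw [abs_le]
    constructor <;> linarith
  refine ⟨D, fun u v hu hv => ?_⟩
  rcases le_total u v with h | h
  · rw [min_eq_left h]
    exact key u v hu h
  · rw [min_eq_right h, add_comm u v, sub_right_comm]
    exact key v u hv h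

/- Layer cake: `ν {t ≤ x⁻¹} ≤ cdf ν t⁻¹` is at most `1` for `t ≤ 1` and `D t ^ (-α)` for `t > 1`. -/
lemma exists_lintegral_rpow_neg_le (hν : IsPowerLawAtZero ν α κ) :
    ∃ D : ℝ, ∀ ρ, 0 < ρ → ρ < α →
      ∫⁻ x, ENNReal.ofReal (x ^ (-ρ)) ∂ν ≤ ENNReal.ofReal (D / (α - ρ)) := by
  obtain ⟨D, hD0, hD⟩ := hν.exists_cdf_le
  refine ⟨α + α * D, fun ρ hρ hρα => ?_⟩
  have hgap : 0 < α - ρ := sub_pos.mpr hρα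
  have hinv : ∀ᵐ x ∂ν, 0 ≤ x⁻¹ := hν.ae_pos.mono fun x hx => (inv_pos.mpr hx).le
  have hsmall : ∫⁻ t in Ioc 0 1, ν {x | t ≤ x⁻¹} * ENNReal.ofReal (t ^ (ρ - 1))
      ≤ ENNReal.ofReal (1 / ρ) := by
    rw [← lintegral_Ioc_ofReal_rpow hρ]
    exact lintegral_mono fun t => mul_le_of_le_one_left' prob_le_one
  have hlarge : ∫⁻ t in Ioi 1, ν {x | t ≤ x⁻¹} * ENNReal.ofReal (t ^ (ρ - 1))
      ≤ ENNReal.ofReal (D / (α - ρ)) := by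
    rw [← lintegral_Ioi_ofReal_mul_rpow hD0.le hgap]
    refine setLIntegral_mono (by fun_prop) fun t (ht : 1 < t) => ?_
    have ht0 : 0 < t := one_pos.trans ht
    have htail : ν {x | t ≤ x⁻¹} ≤ ENNReal.ofReal (D * t⁻¹ ^ α) := calc
      ν {x | t ≤ x⁻¹} ≤ ν (Iic t⁻¹) := measure_mono fun x hx => le_inv_of_le_inv₀ ht0 hx
      _ = ENNReal.ofReal (cdf ν t⁻¹) := (ofReal_cdf ν _).symm
      _ ≤ _ := ENNReal.ofReal_le_ofReal
          (hD α _ hν.exponent_pos.le le_rfl (inv_pos.mpr ht0))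
    refine (mul_le_mul_left htail _).trans_eq ?_
    rw [← ENNReal.ofReal_mul (by positivity), Real.inv_rpow ht0.le, ← Real.rpow_neg ht0.le,
      mul_assoc, ← Real.rpow_add ht0]
    ring_nf
  calc ∫⁻ x, ENNReal.ofReal (x ^ (-ρ)) ∂ν = ∫⁻ x, ENNReal.ofReal (x⁻¹ ^ ρ) ∂ν := by
        refine lintegral_congr_ae (hν.ae_pos.mono fun x hx => ?_)
        simp only [Real.inv_rpow hx.le, Real.rpow_neg hx.le]
    _ = ENNReal.ofReal ρ * ∫⁻ t in Ioi 0, ν {x | t ≤ x⁻¹} * ENNReal.ofReal (t ^ (ρ - 1)) :=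
        lintegral_rpow_eq_lintegral_meas_le_mul ν hinv measurable_inv.aemeasurable hρ
    _ ≤ ENNReal.ofReal ρ * (ENNReal.ofReal (1 / ρ) + ENNReal.ofReal (D / (α - ρ))) := by
        rw [← Ioc_union_Ioi_eq_Ioi zero_le_one,
          lintegral_union measurableSet_Ioi (Ioc_disjoint_Ioi le_rfl)]
        gcongr
    _ ≤ ENNReal.ofReal ((α + α * D) / (α - ρ)) := by
        rw [← ENNReal.ofReal_add (by positivity) (by positivity), ← ENNReal.ofReal_mul hρ.le]
        refine ENNReal.ofReal_le_ofReal ?_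
        rw [le_div_iff₀ hgap]
        field_simp
        nlinarith

lemma integrable_rpow_neg (hν : IsPowerLawAtZero ν α κ) {ρ : ℝ} (hρ : 0 < ρ) (hρα : ρ < α) :
    Integrable (fun x => x ^ (-ρ)) ν := by
  obtain ⟨D, hD⟩ := hν.exists_lintegral_rpow_neg_le
  refine ⟨by fun_prop, ?_⟩
  rw [hasFiniteIntegral_iff_ofReal (hν.ae_pos.mono fun x hx => Real.rpow_nonneg hx.le _)]
  exact (hD ρ hρ hρα).trans_lt ENNReal.ofReal_lt_top

lemma exists_integral_rpow_neg_le (hν : IsPowerLawAtZero ν α κ) :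
    ∃ D : ℝ, ∀ ρ, 0 < ρ → ρ < α → ∫ x, x ^ (-ρ) ∂ν ≤ D / (α - ρ) := by
  obtain ⟨D, hD⟩ := hν.exists_lintegral_rpow_neg_le
  refine ⟨max D 0, fun ρ hρ hρα => ?_⟩
  have hgap : 0 < α - ρ := sub_pos.mpr hρα
  rw [integral_eq_lintegral_of_nonneg_ae (hν.ae_pos.mono fun x hx => Real.rpow_nonneg hx.le _)
    (by fun_prop)]
  refine ENNReal.toReal_le_of_le_ofReal (by positivity) ((hD ρ hρ hρα).trans ?_)
  exact ENNReal.ofReal_le_ofReal (div_le_div_of_nonneg_right (le_max_left _ _) hgap.le)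

lemma integral_rpow_neg_pos (hν : IsPowerLawAtZero ν α κ) {ρ : ℝ} (hρ : 0 < ρ) (hρα : ρ < α) :
    0 < ∫ x, x ^ (-ρ) ∂ν :=
  integral_rpow_pos hν.ae_pos (hν.integrable_rpow_neg hρ hρα)

end IsPowerLawAtZero

section Product

lemma measureReal_prod_eq_integral_symm {X Y : Type*} [MeasurableSpace X] [MeasurableSpace Y]
    (ν : Measure X) (τ : Measure Y) [IsFiniteMeasure ν] [SFinite τ] {S : Set (X × Y)}
    (hS : MeasurableSet S) : (ν.prod τ).real S = ∫ y, ν.real {x | (x, y) ∈ S} ∂τ := by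
  rw [measureReal_def, Measure.prod_apply_symm hS]
  exact (integral_toReal (measurable_measure_prodMk_right hS).aemeasurable
    (ae_of_all _ fun _ => measure_lt_top _ _)).symm

variable {ν₁ ν₂ : Measure ℝ} [IsProbabilityMeasure ν₁] [IsProbabilityMeasure ν₂]

lemma integral_cdf_div_eq_measureReal_mul_le (h₂ : ∀ᵐ y ∂ν₂, 0 < y) (c : ℝ) :
    ∫ y, cdf ν₁ (c / y) ∂ν₂ = (ν₁.prod ν₂).real {z | z.1 * z.2 ≤ c} := by
  have hset : MeasurableSet {z : ℝ × ℝ | z.1 * z.2 ≤ c} :=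
    measurableSet_le (by fun_prop) measurable_const
  rw [measureReal_prod_eq_integral_symm _ _ hset]
  refine integral_congr_ae (h₂.mono fun y hy => ?_)
  simp only [cdf_eq_real]
  congr 1
  ext x
  exact le_div_iff₀ hy

lemma integral_cdf_div_comm (h₁ : ∀ᵐ x ∂ν₁, 0 < x) (h₂ : ∀ᵐ y ∂ν₂, 0 < y) (c : ℝ) :
    ∫ y, cdf ν₁ (c / y) ∂ν₂ = ∫ x, cdf ν₂ (c / x) ∂ν₁ := by
  rw [integral_cdf_div_eq_measureReal_mul_le h₂, integral_cdf_div_eq_measureReal_mul_le h₁,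
    ← Measure.prod_swap, map_measureReal_apply measurable_swap
      (measurableSet_le (by fun_prop) measurable_const)]
  simp only [preimage_ofPred_eq, Prod.fst_swap, Prod.snd_swap, mul_comm]

end Product

section TruncatedRatio

variable {ν : Measure ℝ} {α : ℝ}

lemma ae_norm_min_one_div_rpow_le (hν : ∀ᵐ y ∂ν, 0 < y) (hα : 0 ≤ α) {t : ℝ} (ht : 0 ≤ t) :
    ∀ᵐ y ∂ν, ‖min 1 (t / y) ^ α‖ ≤ 1 := by
  filter_upwards [hν] with y hy
  have hmin : 0 ≤ min 1 (t / y) := le_min zero_le_one (by positivity)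
  rw [Real.norm_of_nonneg (Real.rpow_nonneg hmin _)]
  exact Real.rpow_le_one hmin (min_le_left _ _) hα

variable [IsFiniteMeasure ν]

lemma integrable_min_one_div_rpow (hν : ∀ᵐ y ∂ν, 0 < y) (hα : 0 ≤ α) {t : ℝ} (ht : 0 ≤ t) :
    Integrable (fun y => min 1 (t / y) ^ α) ν :=
  .of_bound (Measurable.aestronglyMeasurable (by fun_prop)) 1
    (ae_norm_min_one_div_rpow_le hν hα ht)

lemma tendsto_integral_min_one_div_rpow (hν : ∀ᵐ y ∂ν, 0 < y) (hα : 0 < α) :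
    Tendsto (fun t => ∫ y, min 1 (t / y) ^ α ∂ν) (𝓝[>] 0) (𝓝 0) := by
  have hlim : Tendsto (fun t => ∫ y, min 1 (t / y) ^ α ∂ν) (𝓝[>] 0) (𝓝 (∫ _, 0 ∂ν)) := by
    refine tendsto_integral_filter_of_dominated_convergence (fun _ => 1)
      (.of_forall fun t => Measurable.aestronglyMeasurable (by fun_prop)) ?_
      (integrable_const _) (.of_forall fun y => ?_)
    · filter_upwards [self_mem_nhdsWithin] with t (ht : 0 < t)
      exact ae_norm_min_one_div_rpow_le hν hα.le ht.le
    · have hcont : ContinuousAt (fun t : ℝ => min 1 (t / y) ^ α) 0 :=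
        ContinuousAt.rpow_const (by fun_prop) (.inr hα.le)
      simpa [ContinuousAt, Real.zero_rpow hα.ne'] using hcont.tendsto.mono_left nhdsWithin_le_nhds
  simpa using hlim

end TruncatedRatio

/-! ### Splitting the outage probability of the relay link -/

/-- `P(X Y ≤ s U)` for independent `U`, `X`, `Y` with the laws `τ`, `ν₁`, `ν₂` on `(0, ∞)`. -/
def productAverage (τ ν₁ ν₂ : Measure ℝ) (s : ℝ) : ℝ :=
  ∫ z, cdf ν₁ (s * (z.1 / z.2)) ∂τ.prod ν₂

/-- `P(X Y / (Y + t) ≤ s U)` for independent `U`, `X`, `Y` with the laws `τ`, `ν₁`, `ν₂` on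
`(0, ∞)`: the average over the threshold `U` of the distribution function of the end-to-end SNR of
a fixed-gain link, `s` and `t` being proportional to the inverses of the SNRs of the two hops. -/
def relayAverage (τ ν₁ ν₂ : Measure ℝ) (s t : ℝ) : ℝ :=
  ∫ z, cdf ν₁ (s * z.1 * (1 + t / z.2)) ∂τ.prod ν₂

lemma productAverage_nonneg (τ ν₁ ν₂ : Measure ℝ) (s : ℝ) : 0 ≤ productAverage τ ν₁ ν₂ s :=
  integral_nonneg fun _ => cdf_nonneg ν₁ _

lemma relayAverage_nonneg (τ ν₁ ν₂ : Measure ℝ) (s t : ℝ) : 0 ≤ relayAverage τ ν₁ ν₂ s t :=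
  integral_nonneg fun _ => cdf_nonneg ν₁ _

section Ratio

variable {τ ν : Measure ℝ}

lemma ae_prod_pos (hτ : ∀ᵐ u ∂τ, 0 < u) (hν : ∀ᵐ y ∂ν, 0 < y) :
    ∀ᵐ z ∂τ.prod ν, 0 < z.1 ∧ 0 < z.2 :=
  (Measure.quasiMeasurePreserving_fst.ae hτ).and (Measure.quasiMeasurePreserving_snd.ae hν)

lemma rpow_div_ae_eq (hτ : ∀ᵐ u ∂τ, 0 < u) (hν : ∀ᵐ y ∂ν, 0 < y) (ρ : ℝ) :
    (fun z : ℝ × ℝ => (z.1 / z.2) ^ ρ) =ᵐ[τ.prod ν] fun z => z.1 ^ ρ * z.2 ^ (-ρ) := by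
  filter_upwards [ae_prod_pos hτ hν] with z hz
  rw [Real.div_rpow hz.1.le hz.2.le, Real.rpow_neg hz.2.le, div_eq_mul_inv]

lemma integrable_rpow_div (hτ : ∀ᵐ u ∂τ, 0 < u) (hν : ∀ᵐ y ∂ν, 0 < y) {ρ : ℝ}
    (hτρ : Integrable (fun u => u ^ ρ) τ) (hνρ : Integrable (fun y => y ^ (-ρ)) ν) :
    Integrable (fun z : ℝ × ℝ => (z.1 / z.2) ^ ρ) (τ.prod ν) :=
  (hτρ.mul_prod hνρ).congr (rpow_div_ae_eq hτ hν ρ).symm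

variable [SFinite τ] [SFinite ν]

lemma integral_rpow_div (hτ : ∀ᵐ u ∂τ, 0 < u) (hν : ∀ᵐ y ∂ν, 0 < y) (ρ : ℝ) :
    ∫ z, (z.1 / z.2) ^ ρ ∂τ.prod ν = (∫ u, u ^ ρ ∂τ) * ∫ y, y ^ (-ρ) ∂ν := by
  rw [integral_congr_ae (rpow_div_ae_eq hτ hν ρ),
    integral_prod_mul (fun u : ℝ => u ^ ρ) fun y : ℝ => y ^ (-ρ)]

end Ratio

section Threshold

variable {τ : Measure ℝ} [IsProbabilityMeasure τ] {α ρ : ℝ}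

lemma rpow_le_one_add_rpow {u : ℝ} (hu : 0 ≤ u) (hρ : 0 ≤ ρ) (hρα : ρ ≤ α) :
    u ^ ρ ≤ 1 + u ^ α := by
  rcases le_total u 1 with h | h
  · exact (Real.rpow_le_one hu h hρ).trans (le_add_of_nonneg_right (Real.rpow_nonneg hu α))
  · exact (Real.rpow_le_rpow_of_exponent_le h hρα).trans (le_add_of_nonneg_left zero_le_one)

lemma integrable_rpow_of_le (hτ : ∀ᵐ u ∂τ, 0 < u) (hτα : Integrable (fun u => u ^ α) τ)
    (hρ : 0 ≤ ρ) (hρα : ρ ≤ α) : Integrable (fun u => u ^ ρ) τ := by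
  refine ((integrable_const (1 : ℝ)).add hτα).mono' (by fun_prop) ?_
  filter_upwards [hτ] with u hu
  rw [Real.norm_of_nonneg (Real.rpow_nonneg hu.le ρ)]
  exact rpow_le_one_add_rpow hu.le hρ hρα

lemma integral_rpow_le_one_add (hτ : ∀ᵐ u ∂τ, 0 < u) (hτα : Integrable (fun u => u ^ α) τ)
    (hρ : 0 ≤ ρ) (hρα : ρ ≤ α) : ∫ u, u ^ ρ ∂τ ≤ 1 + ∫ u, u ^ α ∂τ := by
  have h : ∫ u, u ^ ρ ∂τ ≤ ∫ u, (1 + u ^ α) ∂τ :=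
    integral_mono_ae (integrable_rpow_of_le hτ hτα hρ hρα) ((integrable_const 1).add hτα)
      (hτ.mono fun u hu => rpow_le_one_add_rpow hu.le hρ hρα)
  simpa [integral_add (integrable_const (1 : ℝ)) hτα] using h

end Threshold

section Link

variable {τ ν₁ ν₂ : Measure ℝ} [IsProbabilityMeasure τ] [IsProbabilityMeasure ν₂]
  {α β κ₁ κ₂ : ℝ}

lemma relayAverage_sub_eq_integral (s t : ℝ) :
    relayAverage τ ν₁ ν₂ s t - ∫ u, cdf ν₁ (s * u) ∂τ - productAverage τ ν₁ ν₂ (s * t)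
      = ∫ z, (cdf ν₁ (s * z.1 * (1 + t / z.2)) - cdf ν₁ (s * z.1)
          - cdf ν₁ (s * t * (z.1 / z.2))) ∂τ.prod ν₂ := by
  have hcdf : ∀ f : ℝ × ℝ → ℝ, Measurable f → Integrable (fun z => cdf ν₁ (f z)) (τ.prod ν₂) :=
    fun f hf => integrable_cdf_comp ν₁ hf
  have hmarginal : ∫ z, cdf ν₁ (s * z.1) ∂τ.prod ν₂ = ∫ u, cdf ν₁ (s * u) ∂τ := by
    simp [integral_fun_fst (μ := τ) (ν := ν₂) fun u => cdf ν₁ (s * u)]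
  have hrelay := hcdf (fun z => s * z.1 * (1 + t / z.2)) (by fun_prop)
  have hfirst := hcdf (fun z => s * z.1) (by fun_prop)
  rw [← hmarginal, relayAverage, productAverage, ← integral_sub hrelay hfirst]
  exact (integral_sub (hrelay.sub hfirst) (hcdf (fun z => s * t * (z.1 / z.2)) (by fun_prop))).symm

variable [IsProbabilityMeasure ν₁]

lemma productAverage_comm (h₁ : ∀ᵐ x ∂ν₁, 0 < x) (h₂ : ∀ᵐ y ∂ν₂, 0 < y) (s : ℝ) :
    productAverage τ ν₁ ν₂ s = productAverage τ ν₂ ν₁ s := by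
  rw [productAverage, productAverage, integral_prod _ (integrable_cdf_comp ν₁ (by fun_prop)),
    integral_prod _ (integrable_cdf_comp ν₂ (by fun_prop))]
  simp only [← mul_div_assoc, integral_cdf_div_comm h₁ h₂]

lemma exists_productAverage_le (hτ : ∀ᵐ u ∂τ, 0 < u) (hτα : Integrable (fun u => u ^ α) τ)
    (h₁ : IsPowerLawAtZero ν₁ α κ₁) (h₂ : IsPowerLawAtZero ν₂ β κ₂) :
    ∃ D : ℝ, ∀ ρ s, 0 < ρ → ρ ≤ α → ρ < β → 0 < s →
      productAverage τ ν₁ ν₂ s ≤ D / (β - ρ) * s ^ ρ := by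
  obtain ⟨D₁, hD₁, hcdf⟩ := h₁.exists_cdf_le
  obtain ⟨D₂, hD₂⟩ := h₂.exists_integral_rpow_neg_le
  refine ⟨D₁ * ((1 + ∫ u, u ^ α ∂τ) * D₂), fun ρ s hρ hρα hρβ hs => ?_⟩
  have hτρ := integrable_rpow_of_le hτ hτα hρ.le hρα
  have hmoment : ∫ z, (z.1 / z.2) ^ ρ ∂τ.prod ν₂ ≤ (1 + ∫ u, u ^ α ∂τ) * (D₂ / (β - ρ)) := by
    rw [integral_rpow_div hτ h₂.ae_pos]
    have hτ0 : 0 ≤ ∫ u, u ^ ρ ∂τ :=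
      integral_nonneg_of_ae (hτ.mono fun u hu => Real.rpow_nonneg hu.le _)
    exact mul_le_mul (integral_rpow_le_one_add hτ hτα hρ.le hρα) (hD₂ ρ hρ hρβ)
      (h₂.integral_rpow_neg_pos hρ hρβ).le
      (hτ0.trans (integral_rpow_le_one_add hτ hτα hρ.le hρα))
  calc productAverage τ ν₁ ν₂ s
      ≤ D₁ * s ^ ρ * ∫ z, (z.1 / z.2) ^ ρ ∂τ.prod ν₂ :=
        integral_comp_mul_le (cdf_nonneg ν₁)
          ((ae_prod_pos hτ h₂.ae_pos).mono fun z hz => div_pos hz.1 hz.2)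
          (fun s hs => hcdf ρ s hρ.le hρα hs)
          (integrable_rpow_div hτ h₂.ae_pos hτρ (h₂.integrable_rpow_neg hρ hρβ)) hs
    _ ≤ D₁ * s ^ ρ * ((1 + ∫ u, u ^ α ∂τ) * (D₂ / (β - ρ))) :=
        mul_le_mul_of_nonneg_left hmoment (by positivity)
    _ = _ := by ring

lemma integral_cdf_mul_isEquivalent (hτ : ∀ᵐ u ∂τ, 0 < u)
    (hτα : Integrable (fun u => u ^ α) τ) (h₁ : IsPowerLawAtZero ν₁ α κ₁) :
    (fun s => ∫ u, cdf ν₁ (s * u) ∂τ) ~[𝓝[>] 0] fun s => κ₁ * (∫ u, u ^ α ∂τ) * s ^ α := by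
  obtain ⟨D, -, hD⟩ := h₁.exists_cdf_le
  refine isEquivalent_const_mul_rpow_of_tendsto_div
    (mul_pos h₁.coeff_pos (integral_rpow_pos hτ hτα)).ne' ?_
  refine tendsto_integral_comp_mul_div_rpow (D := D) (measurable_cdf ν₁) aemeasurable_id hτ
    (fun s hs => ?_) h₁.tendsto_cdf_div hτα
  rw [abs_of_nonneg (cdf_nonneg ν₁ s)]
  exact hD α s h₁.exponent_pos.le le_rfl hs

/- By symmetry `P(X Y ≤ s U)` is an average of `P(Y ≤ s U / X)`, and `X ^ (-β)` is integrable. -/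
lemma productAverage_isEquivalent (hτ : ∀ᵐ u ∂τ, 0 < u) (hτβ : Integrable (fun u => u ^ β) τ)
    (h₁ : IsPowerLawAtZero ν₁ α κ₁) (h₂ : IsPowerLawAtZero ν₂ β κ₂) (hβα : β < α) :
    productAverage τ ν₁ ν₂ ~[𝓝[>] 0]
      fun s => κ₂ * ((∫ u, u ^ β ∂τ) * ∫ x, x ^ (-β) ∂ν₁) * s ^ β := by
  obtain ⟨D, -, hD⟩ := h₂.exists_cdf_le
  refine isEquivalent_const_mul_rpow_of_tendsto_div (mul_pos h₂.coeff_pos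
    (mul_pos (integral_rpow_pos hτ hτβ) (h₁.integral_rpow_neg_pos h₂.exponent_pos hβα))).ne' ?_
  simp only [productAverage_comm h₁.ae_pos h₂.ae_pos, ← integral_rpow_div hτ h₁.ae_pos]
  refine tendsto_integral_comp_mul_div_rpow (D := D) (measurable_cdf ν₂)
    (measurable_fst.div measurable_snd).aemeasurable
    ((ae_prod_pos hτ h₁.ae_pos).mono fun z hz => div_pos hz.1 hz.2) (fun s hs => ?_)
    h₂.tendsto_cdf_div
    (integrable_rpow_div hτ h₁.ae_pos hτβ (h₁.integrable_rpow_neg h₂.exponent_pos hβα))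
  rw [abs_of_nonneg (cdf_nonneg ν₂ s)]
  exact hD β s h₂.exponent_pos.le le_rfl hs

/- Near-additivity of `cdf ν₁` at `s U` and `s U t / Y`. -/
lemma exists_abs_relayAverage_sub_le (hτ : ∀ᵐ u ∂τ, 0 < u) (hτα : Integrable (fun u => u ^ α) τ)
    (h₁ : IsPowerLawAtZero ν₁ α κ₁) (h₂ : ∀ᵐ y ∂ν₂, 0 < y) :
    ∃ D : ℝ, ∀ s t, 0 < s → 0 < t →
      |relayAverage τ ν₁ ν₂ s t - ∫ u, cdf ν₁ (s * u) ∂τ - productAverage τ ν₁ ν₂ (s * t)|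
        ≤ D * s ^ α * ∫ y, min 1 (t / y) ^ α ∂ν₂ := by
  obtain ⟨D, hD⟩ := h₁.exists_abs_cdf_add_sub_le
  refine ⟨D * ∫ u, u ^ α ∂τ, fun s t hs ht => ?_⟩
  have hprod : ∫ z : ℝ × ℝ, D * s ^ α * (z.1 ^ α * min 1 (t / z.2) ^ α) ∂τ.prod ν₂
      = D * (∫ u, u ^ α ∂τ) * s ^ α * ∫ y, min 1 (t / y) ^ α ∂ν₂ := by
    rw [integral_const_mul,
      integral_prod_mul (fun u : ℝ => u ^ α) fun y : ℝ => min 1 (t / y) ^ α]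
    ring
  rw [relayAverage_sub_eq_integral, ← hprod, ← Real.norm_eq_abs]
  refine norm_integral_le_of_norm_le ((hτα.mul_prod
    (integrable_min_one_div_rpow h₂ h₁.exponent_pos.le ht.le)).const_mul _) ?_
  filter_upwards [ae_prod_pos hτ h₂] with z ⟨hu, hy⟩
  have hmin : min (s * z.1) (s * t * (z.1 / z.2)) = s * z.1 * min 1 (t / z.2) := by
    rw [mul_min_of_nonneg _ _ (by positivity), mul_one]
    congr 1
    ring
  have h := hD (s * z.1) (s * t * (z.1 / z.2)) (by positivity) (by positivity)
  rw [hmin, Real.mul_rpow (by positivity) (le_min zero_le_one (by positivity)),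
    Real.mul_rpow hs.le hu.le] at h
  rw [Real.norm_eq_abs, show s * z.1 * (1 + t / z.2) = s * z.1 + s * t * (z.1 / z.2) by ring]
  exact h.trans_eq (by ring)

lemma isLittleO_relayAverage_sub {ι : Type*} {l : Filter ι} {s t : ι → ℝ}
    (hτ : ∀ᵐ u ∂τ, 0 < u) (hτα : Integrable (fun u => u ^ α) τ)
    (h₁ : IsPowerLawAtZero ν₁ α κ₁) (h₂ : ∀ᵐ y ∂ν₂, 0 < y)
    (hs : Tendsto s l (𝓝[>] 0)) (ht : Tendsto t l (𝓝[>] 0)) :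
    (fun i => relayAverage τ ν₁ ν₂ (s i) (t i) - ∫ u, cdf ν₁ (s i * u) ∂τ
      - productAverage τ ν₁ ν₂ (s i * t i)) =o[l] fun i => s i ^ α := by
  obtain ⟨D, hD⟩ := exists_abs_relayAverage_sub_le hτ hτα h₁ h₂
  have hsmall : (fun i => D * s i ^ α * ∫ y, min 1 (t i / y) ^ α ∂ν₂) =o[l] fun i => s i ^ α := by
    simpa only [mul_one, Function.comp_def] using
      ((isBigO_refl (fun i => s i ^ α) l).const_mul_left D).mul_isLittleO
        ((isLittleO_one_iff ℝ).mpr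
          ((tendsto_integral_min_one_div_rpow h₂ h₁.exponent_pos).comp ht))
  refine IsBigO.trans_isLittleO (.of_norm_eventuallyLE ?_) hsmall
  filter_upwards [hs.eventually self_mem_nhdsWithin, ht.eventually self_mem_nhdsWithin]
    with i hsi hti using hD _ _ hsi hti

lemma productAverage_isBigO_of_lt (hτ : ∀ᵐ u ∂τ, 0 < u) (hτα : Integrable (fun u => u ^ α) τ)
    (h₁ : IsPowerLawAtZero ν₁ α κ₁) (h₂ : IsPowerLawAtZero ν₂ β κ₂) (hαβ : α < β) :
    productAverage τ ν₁ ν₂ =O[𝓝[>] 0] fun s => s ^ α := by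
  obtain ⟨D, hD⟩ := exists_productAverage_le hτ hτα h₁ h₂
  refine .of_bound (D / (β - α)) ?_
  filter_upwards [self_mem_nhdsWithin] with s (hs : 0 < s)
  rw [Real.norm_of_nonneg (productAverage_nonneg _ _ _ _), Real.norm_of_nonneg (by positivity)]
  exact hD α s h₁.exponent_pos le_rfl hαβ hs

/- The exponent `ρ = α - 1 / |log s|` gives `s ^ ρ = e * s ^ α` and `1 / (α - ρ) = |log s|`. -/
lemma productAverage_isBigO_of_eq (hτ : ∀ᵐ u ∂τ, 0 < u) (hτα : Integrable (fun u => u ^ α) τ)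
    (h₁ : IsPowerLawAtZero ν₁ α κ₁) (h₂ : IsPowerLawAtZero ν₂ α κ₂) :
    productAverage τ ν₁ ν₂ =O[𝓝[>] 0] fun s => Real.log s * s ^ α := by
  obtain ⟨D, hD⟩ := exists_productAverage_le hτ hτα h₁ h₂
  have hα := h₁.exponent_pos
  refine .of_bound (D * Real.exp 1) ?_
  filter_upwards [self_mem_nhdsWithin,
    Real.tendsto_log_nhdsGT_zero.eventually_lt_atBot (-(1 / α))] with s (hs : 0 < s) hlog
  have hL : 0 < -Real.log s := (one_div_pos.mpr hα).trans (by linarith)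
  have hLα : 1 / -Real.log s < α := (one_div_lt hL hα).mpr (by linarith)
  have hexp : s ^ (α - 1 / -Real.log s) = Real.exp 1 * s ^ α := by
    rw [Real.rpow_sub hs, Real.rpow_def_of_pos hs (1 / _), mul_one_div, div_neg,
      div_self (neg_ne_zero.mp hL.ne'), Real.exp_neg, div_inv_eq_mul, mul_comm]
  calc ‖productAverage τ ν₁ ν₂ s‖ = productAverage τ ν₁ ν₂ s :=
        Real.norm_of_nonneg (productAverage_nonneg _ _ _ _)
    _ ≤ D / (α - (α - 1 / -Real.log s)) * s ^ (α - 1 / -Real.log s) :=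
        hD _ s (by linarith) (by linarith [one_div_pos.mpr hL])
          (by linarith [one_div_pos.mpr hL]) hs
    _ = D * Real.exp 1 * (-Real.log s * s ^ α) := by
        rw [sub_sub_cancel, div_div_eq_mul_div, div_one, hexp]
        ring
    _ = D * Real.exp 1 * ‖Real.log s * s ^ α‖ := by
        rw [norm_mul, Real.norm_of_nonpos (by linarith), Real.norm_of_nonneg (by positivity)]

section Filter

variable {ι : Type*} {l : Filter ι} {s t : ι → ℝ}

lemma isLittleO_productAverage_of_lt (hτ : ∀ᵐ u ∂τ, 0 < u)
    (hτα : Integrable (fun u => u ^ α) τ) (h₁ : IsPowerLawAtZero ν₁ α κ₁)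
    (h₂ : IsPowerLawAtZero ν₂ β κ₂) (hαβ : α < β)
    (hs : Tendsto s l (𝓝[>] 0)) (ht : Tendsto t l (𝓝[>] 0)) :
    (fun i => productAverage τ ν₁ ν₂ (s i * t i)) =o[l] fun i => s i ^ α :=
  ((productAverage_isBigO_of_lt hτ hτα h₁ h₂ hαβ).comp_tendsto
    (tendsto_mul_nhdsGT_zero hs ht)).trans_isLittleO
      (isLittleO_mul_rpow h₁.exponent_pos le_rfl hs ht)

lemma isLittleO_productAverage_of_log (hτ : ∀ᵐ u ∂τ, 0 < u)
    (hτα : Integrable (fun u => u ^ α) τ) (h₁ : IsPowerLawAtZero ν₁ α κ₁)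
    (h₂ : IsPowerLawAtZero ν₂ α κ₂)
    (hs : Tendsto s l (𝓝[>] 0)) (ht : Tendsto t l (𝓝[>] 0))
    (hlog : (fun i => Real.log (s i)) =o[l] fun i => t i ^ (-α)) :
    (fun i => productAverage τ ν₁ ν₂ (s i * t i)) =o[l] fun i => s i ^ α := by
  have hlog' : (fun i => Real.log (s i) + Real.log (t i)) =o[l] fun i => t i ^ (-α) :=
    hlog.add ((isLittleO_log_rpow_nhdsGT_zero (neg_lt_zero.mpr h₁.exponent_pos)).comp_tendsto ht)
  refine ((productAverage_isBigO_of_eq hτ hτα h₁ h₂).comp_tendsto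
    (tendsto_mul_nhdsGT_zero hs ht)).trans_isLittleO ?_
  refine (hlog'.mul_isBigO (isBigO_refl (fun i => (s i * t i) ^ α) l)).congr' ?_ ?_
  all_goals
    filter_upwards [hs.eventually self_mem_nhdsWithin, ht.eventually self_mem_nhdsWithin]
      with i (hsi : 0 < s i) (hti : 0 < t i)
  · simp only [Function.comp_apply, Real.log_mul hsi.ne' hti.ne']
  · rw [Real.mul_rpow hsi.le hti.le, mul_left_comm, ← Real.rpow_add hti, neg_add_cancel,
      Real.rpow_zero, mul_one]

lemma relayAverage_isEquivalent (hτ : ∀ᵐ u ∂τ, 0 < u)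
    (hτα : Integrable (fun u => u ^ α) τ) (h₁ : IsPowerLawAtZero ν₁ α κ₁)
    (h₂ : ∀ᵐ y ∂ν₂, 0 < y) (hs : Tendsto s l (𝓝[>] 0)) (ht : Tendsto t l (𝓝[>] 0))
    (hprod : (fun i => productAverage τ ν₁ ν₂ (s i * t i)) =o[l] fun i => s i ^ α) :
    (fun i => relayAverage τ ν₁ ν₂ (s i) (t i)) ~[l]
      fun i => κ₁ * (∫ u, u ^ α ∂τ) * s i ^ α := by
  have hcoeff := (mul_pos h₁.coeff_pos (integral_rpow_pos hτ hτα)).ne'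
  have hrest := ((isLittleO_relayAverage_sub hτ hτα h₁ h₂ hs ht).add hprod).const_mul_right hcoeff
  refine (((integral_cdf_mul_isEquivalent hτ hτα h₁).comp_tendsto hs).add_isLittleO
    hrest).congr_left (.of_forall fun i => ?_)
  simp only [Pi.add_apply, Function.comp_apply]
  ring

lemma relayAverage_isEquivalent_add (hτ : ∀ᵐ u ∂τ, 0 < u)
    (hτα : Integrable (fun u => u ^ α) τ) (hτβ : Integrable (fun u => u ^ β) τ)
    (h₁ : IsPowerLawAtZero ν₁ α κ₁)
    (h₂ : IsPowerLawAtZero ν₂ β κ₂) (hβα : β < α)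
    (hs : Tendsto s l (𝓝[>] 0)) (ht : Tendsto t l (𝓝[>] 0)) :
    (fun i => relayAverage τ ν₁ ν₂ (s i) (t i)) ~[l]
      fun i => κ₁ * (∫ u, u ^ α ∂τ) * s i ^ α
        + κ₂ * ((∫ u, u ^ β ∂τ) * ∫ x, x ^ (-β) ∂ν₁) * (s i * t i) ^ β := by
  have hα : ∀ᶠ i in l, 0 ≤ κ₁ * (∫ u, u ^ α ∂τ) * s i ^ α := by
    filter_upwards [hs.eventually self_mem_nhdsWithin] with i (hsi : 0 < s i)
    exact mul_nonneg (mul_pos h₁.coeff_pos (integral_rpow_pos hτ hτα)).le (by positivity)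
  have hβ : ∀ᶠ i in l, 0 ≤ κ₂ * ((∫ u, u ^ β ∂τ) * ∫ x, x ^ (-β) ∂ν₁) * (s i * t i) ^ β := by
    filter_upwards [(tendsto_mul_nhdsGT_zero hs ht).eventually self_mem_nhdsWithin]
      with i (hsti : 0 < s i * t i)
    exact mul_nonneg (mul_pos h₂.coeff_pos (mul_pos (integral_rpow_pos hτ hτβ)
      (h₁.integral_rpow_neg_pos h₂.exponent_pos hβα))).le (by positivity)
  have hmain := isEquivalent_add_of_nonneg
    ((integral_cdf_mul_isEquivalent hτ hτα h₁).comp_tendsto hs)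
    ((productAverage_isEquivalent hτ hτβ h₁ h₂ hβα).comp_tendsto (tendsto_mul_nhdsGT_zero hs ht))
    hα hβ
  have hrest := (isLittleO_relayAverage_sub hτ hτα h₁ h₂.ae_pos hs ht).const_mul_right
    (mul_pos h₁.coeff_pos (integral_rpow_pos hτ hτα)).ne'
  refine (hmain.add_isLittleO (hrest.trans_isBigO (.of_norm_eventuallyLE ?_))).congr_left
    (.of_forall fun i => ?_)
  · filter_upwards [hα, hβ] with i hi hi'
    rw [Real.norm_of_nonneg hi]
    exact le_add_of_nonneg_right hi'
  · simp only [Pi.add_apply, Function.comp_apply]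
    ring

end Filter

end Link

/-! ### Averaging over Gamma distributed thresholds -/

section GammaMeasure

variable {p q : ℝ}

lemma gammaMeasure_eq_withDensity (p q : ℝ) :
    gammaMeasure p q
      = (volume.restrict (Ioi 0)).withDensity fun x => ENNReal.ofReal (gammaPDFReal p q x) := by
  rw [gammaMeasure, ← withDensity_indicator measurableSet_Ioi]
  refine withDensity_congr_ae ?_
  filter_upwards [compl_mem_ae_iff.mpr (measure_singleton (μ := volume) (0 : ℝ))] with x hx
  rcases lt_or_gt_of_ne hx with h | h
  · rw [gammaPDF_of_neg h, indicator_of_notMem (notMem_Ioi.mpr h.le)]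
  · rw [indicator_of_mem (mem_Ioi.mpr h), gammaPDF]

lemma ae_pos_gammaMeasure (p q : ℝ) : ∀ᵐ x ∂gammaMeasure p q, 0 < x :=
  ae_pos_of_eq_withDensity (gammaMeasure_eq_withDensity p q)

lemma eqOn_gammaPDFReal_mul (p q : ℝ) (g : ℝ → ℝ) :
    EqOn (fun x => gammaPDFReal p q x * g x)
      (fun x => q ^ p / Real.Gamma p * (x ^ (p - 1) * Real.exp (-(q * x)) * g x)) (Ioi 0) := by
  intro x (hx : 0 < x)
  simp only [gammaPDFReal, if_pos hx.le]
  ring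

lemma integral_gammaMeasure (hp : 0 < p) (hq : 0 < q) (g : ℝ → ℝ) :
    ∫ x, g x ∂gammaMeasure p q
      = q ^ p / Real.Gamma p * ∫ x in Ioi 0, x ^ (p - 1) * Real.exp (-(q * x)) * g x := by
  rw [integral_of_eq_withDensity (gammaMeasure_eq_withDensity p q) (measurable_gammaPDFReal p q)
    fun x _ => gammaPDFReal_nonneg hp hq x, ← integral_const_mul]
  exact setIntegral_congr_fun measurableSet_Ioi (eqOn_gammaPDFReal_mul p q g)

lemma integrable_gammaMeasure_iff (hp : 0 < p) (hq : 0 < q) (g : ℝ → ℝ) :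
    Integrable g (gammaMeasure p q)
      ↔ IntegrableOn (fun x => x ^ (p - 1) * Real.exp (-(q * x)) * g x) (Ioi 0) := by
  have hc : q ^ p / Real.Gamma p ≠ 0 :=
    (div_pos (Real.rpow_pos_of_pos hq p) (Real.Gamma_pos_of_pos hp)).ne'
  rw [integrable_iff_of_eq_withDensity (gammaMeasure_eq_withDensity p q)
    (measurable_gammaPDFReal p q) fun x _ => gammaPDFReal_nonneg hp hq x,
    integrableOn_congr_fun (eqOn_gammaPDFReal_mul p q g) measurableSet_Ioi,
    IntegrableOn, integrable_const_mul_iff hc.isUnit, IntegrableOn]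

lemma eqOn_rpow_sub_one_mul_exp_mul_rpow (p q σ : ℝ) :
    EqOn (fun x => x ^ (p - 1) * Real.exp (-(q * x)) * x ^ σ)
      (fun x => x ^ (p + σ - 1) * Real.exp (-(q * x))) (Ioi 0) := by
  intro x (hx : 0 < x)
  simp only [add_sub_right_comm, Real.rpow_add hx]
  ring

lemma integrable_rpow_gammaMeasure {σ : ℝ} (hp : 0 < p) (hpσ : 0 < p + σ) (hq : 0 < q) :
    Integrable (fun x => x ^ σ) (gammaMeasure p q) := by
  rw [integrable_gammaMeasure_iff hp hq, integrableOn_congr_fun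
    (eqOn_rpow_sub_one_mul_exp_mul_rpow p q σ) measurableSet_Ioi]
  simpa [neg_mul] using
    integrableOn_rpow_mul_exp_neg_mul_rpow (p := 1) (s := p + σ - 1) (by linarith) one_pos hq

lemma integral_rpow_gammaMeasure {σ : ℝ} (hp : 0 < p) (hpσ : 0 < p + σ) (hq : 0 < q) :
    ∫ x, x ^ σ ∂gammaMeasure p q = Real.Gamma (p + σ) / Real.Gamma p * q ^ (-σ) := by
  rw [integral_gammaMeasure hp hq, setIntegral_congr_fun measurableSet_Ioi
    (eqOn_rpow_sub_one_mul_exp_mul_rpow p q σ), Real.integral_rpow_mul_exp_neg_mul_Ioi hpσ hq,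
    one_div, Real.inv_rpow hq.le, ← Real.rpow_neg hq.le, neg_add, Real.rpow_add hq,
    Real.rpow_neg hq.le p]
  have := (Real.rpow_pos_of_pos hq p).ne'
  field_simp

lemma upperGamma_mul_eq_measureReal_Ici (hp : 0 < p) (hq : 0 < q) {y : ℝ} (hy : 0 ≤ y) :
    upperGamma p (q * y) = Real.Gamma p * (gammaMeasure p q).real (Ici y) := by
  have hindicator : ∫ x in Ioi 0, x ^ (p - 1) * Real.exp (-(q * x)) * (Ici y).indicator 1 x
      = ∫ x in Ioi y, x ^ (p - 1) * Real.exp (-(q * x)) := by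
    have h : ∀ x : ℝ, x ^ (p - 1) * Real.exp (-(q * x)) * (Ici y).indicator 1 x
        = (Ici y).indicator (fun x => x ^ (p - 1) * Real.exp (-(q * x))) x := by
      intro x
      by_cases hx : x ∈ Ici y <;> simp [hx]
    simp_rw [h]
    rw [← integral_Ici_eq_integral_Ioi, ← integral_Ici_eq_integral_Ioi,
      setIntegral_indicator measurableSet_Ici, inter_eq_right.mpr (Ici_subset_Ici.mpr hy)]
  have hscale : ∫ x in Ioi y, (q * x) ^ (p - 1) * Real.exp (-(q * x))
      = q ^ (p - 1) * ∫ x in Ioi y, x ^ (p - 1) * Real.exp (-(q * x)) := by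
    rw [← integral_const_mul]
    refine setIntegral_congr_fun measurableSet_Ioi fun x (hx : y < x) => ?_
    rw [Real.mul_rpow hq.le (hy.trans hx.le)]
    ring
  have hsubst := integral_comp_mul_left_Ioi (fun t : ℝ => t ^ (p - 1) * Real.exp (-t)) y hq
  rw [hscale, smul_eq_mul, eq_inv_mul_iff_mul_eq₀ hq.ne'] at hsubst
  rw [← integral_indicator_one measurableSet_Ici, integral_gammaMeasure hp hq, hindicator,
    upperGamma, ← hsubst, ← mul_assoc, ← mul_assoc,
    mul_div_cancel₀ _ (Real.Gamma_pos_of_pos hp).ne', Real.rpow_sub_one hq.ne',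
    mul_div_cancel₀ _ hq.ne']

end GammaMeasure

section AverageBER

lemma integral_measureReal_Ici (ν τ : Measure ℝ) [IsProbabilityMeasure ν] [IsFiniteMeasure τ] :
    ∫ y, τ.real (Ici y) ∂ν = ∫ x, cdf ν x ∂τ := by
  have hset : MeasurableSet {z : ℝ × ℝ | z.1 ≤ z.2} :=
    measurableSet_le measurable_fst measurable_snd
  calc ∫ y, τ.real (Ici y) ∂ν = (τ.prod ν).real (Prod.swap ⁻¹' {z | z.1 ≤ z.2}) :=
        (measureReal_prod_eq_integral_symm τ ν (measurable_swap hset)).symm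
    _ = (ν.prod τ).real {z | z.1 ≤ z.2} :=
        Measure.measurePreserving_swap.measureReal_preimage hset.nullMeasurableSet
    _ = ∫ x, cdf ν x ∂τ := by
        simp only [cdf_eq_real]
        exact measureReal_prod_eq_integral_symm ν τ hset

variable {Ω : Type*} [MeasurableSpace Ω] {P : Measure Ω} [IsProbabilityMeasure P] {γ : Ω → ℝ}

lemma cdfOf_eq_cdf_map (hγ : AEMeasurable γ P) : cdfOf P γ = cdf (P.map γ) := by
  have := Measure.isProbabilityMeasure_map hγ
  ext x
  rw [cdf_eq_real, map_measureReal_apply_of_aemeasurable hγ measurableSet_Iic]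
  rfl

lemma integral_upperGamma (hγ : AEMeasurable γ P) (hγ0 : ∀ᵐ o ∂P, 0 ≤ γ o) {p q : ℝ} (hp : 0 < p)
    (hq : 0 < q) :
    ∫ o, upperGamma p (q * γ o) ∂P = Real.Gamma p * ∫ x, cdfOf P γ x ∂gammaMeasure p q := by
  have := isProbabilityMeasure_gammaMeasure hp hq
  have := Measure.isProbabilityMeasure_map hγ
  have hanti : Antitone fun y => (gammaMeasure p q).real (Ici y) :=
    fun _ _ h => measureReal_mono (Ici_subset_Ici.mpr h)
  rw [integral_congr_ae (hγ0.mono fun o ho => upperGamma_mul_eq_measureReal_Ici hp hq ho),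
    integral_const_mul, cdfOf_eq_cdf_map hγ, ← integral_measureReal_Ici,
    integral_map hγ hanti.measurable.aestronglyMeasurable]

lemma Modulation.berOfCDF_eq (M : Modulation) (F : ℝ → ℝ) :
    M.berOfCDF F = M.δ / 2 * ∑ k, ∫ x, F x ∂gammaMeasure M.p (M.q k) := by
  simp only [Modulation.berOfCDF, integral_gammaMeasure M.p_pos (M.q_pos _), Finset.mul_sum]
  refine Finset.sum_congr rfl fun k _ => ?_
  have := (Real.Gamma_pos_of_pos M.p_pos).ne'
  field_simp

theorem Modulation.avgBER_eq_berOfCDF (M : Modulation) (hγ : AEMeasurable γ P)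
    (hγ0 : ∀ᵐ o ∂P, 0 ≤ γ o) : M.avgBER P γ = M.berOfCDF (cdfOf P γ) := by
  rw [M.berOfCDF_eq, Modulation.avgBER]
  simp only [integral_upperGamma hγ hγ0 M.p_pos (M.q_pos _), ← Finset.mul_sum]
  have := (Real.Gamma_pos_of_pos M.p_pos).ne'
  field_simp

end AverageBER

/-! ### The Exponential-Generalized Gamma distribution -/

section GeneralizedGamma

variable {a b c α σ t x : ℝ}

lemma rpow_le_rpow_self_mul_exp (ht : 0 ≤ t) (hx : 0 ≤ x) : x ^ t ≤ t ^ t * Real.exp x := by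
  rcases ht.eq_or_lt with rfl | ht
  · simpa using Real.one_le_exp hx
  · have h : x / t ≤ Real.exp (x / t) := by linarith [Real.add_one_le_exp (x / t)]
    have h' := Real.rpow_le_rpow (by positivity) h ht.le
    rwa [← Real.exp_mul, div_mul_cancel₀ _ ht.ne', Real.div_rpow hx ht.le,
      div_le_iff₀' (by positivity)] at h'

lemma rpow_mul_exp_neg_div_rpow_le (hb : 0 < b) (hc : 0 < c) (ht : 0 ≤ t) (hx : 0 ≤ x) :
    x ^ t * Real.exp (-(x / b) ^ c) ≤ b ^ t * (t / c) ^ (t / c) := by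
  have hxb : 0 ≤ x / b := by positivity
  have hu : (x / b) ^ t ≤ (t / c) ^ (t / c) * Real.exp ((x / b) ^ c) := by
    have h := rpow_le_rpow_self_mul_exp (div_nonneg ht hc.le) (Real.rpow_nonneg hxb c)
    rwa [← Real.rpow_mul hxb, mul_div_cancel₀ _ hc.ne'] at h
  rw [Real.div_rpow hx hb.le, div_le_iff₀' (by positivity)] at hu
  rwa [Real.exp_neg, ← div_eq_mul_inv, div_le_iff₀ (Real.exp_pos _), mul_assoc]

/-- The density at `x > 0` of the generalized Gamma distribution with shape parameters `a`, `c` and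
scale parameter `b`. The exponential distribution of mean `b` is the case `a = c = 1`. -/
def generalizedGammaPDF (a b c x : ℝ) : ℝ :=
  c / (b ^ (a * c) * Real.Gamma a) * (x ^ (a * c - 1) * Real.exp (-(x / b) ^ c))

lemma generalizedGammaPDF_nonneg (ha : 0 < a) (hb : 0 < b) (hc : 0 < c) (hx : 0 ≤ x) :
    0 ≤ generalizedGammaPDF a b c x := by
  have := Real.Gamma_pos_of_pos ha
  unfold generalizedGammaPDF
  positivity

lemma generalizedGammaPDF_mul_rpow (a b c σ : ℝ) (hx : 0 < x) :
    generalizedGammaPDF a b c x * x ^ σ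
      = c / (b ^ (a * c) * Real.Gamma a) * (x ^ (a * c - 1 + σ) * Real.exp (-(x / b) ^ c)) := by
  rw [generalizedGammaPDF, Real.rpow_add hx]
  ring

lemma generalizedGammaPDF_div_rpow_sub_one (a b c α : ℝ) (hx : 0 < x) :
    generalizedGammaPDF a b c x / x ^ (α - 1)
      = c / (b ^ (a * c) * Real.Gamma a) * (x ^ (a * c - α) * Real.exp (-(x / b) ^ c)) := by
  rw [div_eq_mul_inv, ← Real.rpow_neg hx.le, generalizedGammaPDF_mul_rpow _ _ _ _ hx]
  ring_nf

lemma exists_generalizedGammaPDF_le (ha : 0 < a) (hb : 0 < b) (hc : 0 < c) (hα : α ≤ a * c) :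
    ∃ D, ∀ x, 0 < x → generalizedGammaPDF a b c x ≤ D * x ^ (α - 1) := by
  have := Real.Gamma_pos_of_pos ha
  refine ⟨c / (b ^ (a * c) * Real.Gamma a)
    * (b ^ (a * c - α) * ((a * c - α) / c) ^ ((a * c - α) / c)), fun x hx => ?_⟩
  rw [← div_le_iff₀ (by positivity), generalizedGammaPDF_div_rpow_sub_one _ _ _ _ hx]
  exact mul_le_mul_of_nonneg_left
    (rpow_mul_exp_neg_div_rpow_le hb hc (sub_nonneg.mpr hα) hx.le) (by positivity)

/- The factor `0 ^ (a * c - α)` is `1` for `α = a * c` and `0` for `α < a * c`. -/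
lemma tendsto_generalizedGammaPDF_div_rpow (ha : 0 < a) (hb : 0 < b) (hc : 0 < c)
    (hα : α ≤ a * c) :
    Tendsto (fun x => generalizedGammaPDF a b c x / x ^ (α - 1)) (𝓝[>] 0)
      (𝓝 (α * (0 ^ (a * c - α) / (b ^ (a * c) * Real.Gamma (a + 1))))) := by
  have hcont : ContinuousAt (fun x : ℝ => c / (b ^ (a * c) * Real.Gamma a)
      * (x ^ (a * c - α) * Real.exp (-(x / b) ^ c))) 0 :=
    continuousAt_const.mul ((Real.continuousAt_rpow_const _ _ (Or.inr (sub_nonneg.mpr hα))).mul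
      ((ContinuousAt.rpow_const (by fun_prop) (Or.inr hc.le)).neg.rexp))
  have hvalue : α * (0 ^ (a * c - α) / (b ^ (a * c) * Real.Gamma (a + 1)))
      = c / (b ^ (a * c) * Real.Gamma a) * (0 ^ (a * c - α) * Real.exp (-(0 / b) ^ c)) := by
    have := (Real.Gamma_pos_of_pos ha).ne'
    rw [zero_div, Real.zero_rpow hc.ne', neg_zero, Real.exp_zero, Real.Gamma_add_one ha.ne']
    rcases hα.eq_or_lt with rfl | hα
    · field_simp
    · simp [Real.zero_rpow (sub_pos.mpr hα).ne']
  rw [hvalue]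
  refine (hcont.tendsto.mono_left nhdsWithin_le_nhds).congr' ?_
  filter_upwards [self_mem_nhdsWithin] with x hx
  exact (generalizedGammaPDF_div_rpow_sub_one _ _ _ _ hx).symm

lemma eqOn_generalizedGammaPDF_mul_rpow_neg (hb : 0 < b) :
    EqOn (fun x => generalizedGammaPDF a b c x * x ^ (-σ))
      (fun x => c / (b ^ (a * c) * Real.Gamma a)
        * (x ^ (a * c - 1 - σ) * Real.exp (-b ^ (-c) * x ^ c))) (Ioi 0) := by
  intro x hx
  have hexp : (x / b) ^ c = b ^ (-c) * x ^ c := by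
    rw [Real.div_rpow (le_of_lt hx) hb.le, Real.rpow_neg hb.le, div_eq_inv_mul]
  simp only [generalizedGammaPDF_mul_rpow _ _ _ _ hx, hexp, neg_mul, sub_eq_add_neg]

lemma integrableOn_generalizedGammaPDF_mul_rpow_neg (hb : 0 < b) (hc : 0 < c) (hσ : σ < a * c) :
    IntegrableOn (fun x => generalizedGammaPDF a b c x * x ^ (-σ)) (Ioi 0) :=
  (integrableOn_congr_fun (eqOn_generalizedGammaPDF_mul_rpow_neg hb) measurableSet_Ioi).mpr
    ((integrableOn_rpow_mul_exp_neg_mul_rpow (by linarith) hc (by positivity)).const_mul _)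

lemma integral_generalizedGammaPDF_mul_rpow_neg (hb : 0 < b) (hc : 0 < c) (hσ : σ < a * c) :
    ∫ x in Ioi 0, generalizedGammaPDF a b c x * x ^ (-σ)
      = Real.Gamma (a - σ / c) / (Real.Gamma a * b ^ σ) := by
  have hscale : (b ^ (-c)) ^ (-(a * c - 1 - σ + 1) / c) = b ^ (a * c) / b ^ σ := by
    rw [← Real.rpow_mul hb.le, ← Real.rpow_sub hb]
    congr 1
    field_simp
    ring
  have hshape : (a * c - 1 - σ + 1) / c = a - σ / c := by
    field_simp
    ring
  rw [setIntegral_congr_fun measurableSet_Ioi (eqOn_generalizedGammaPDF_mul_rpow_neg hb),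
    integral_const_mul, integral_rpow_mul_exp_neg_mul_rpow hc (by linarith) (by positivity),
    hscale, hshape]
  field_simp

end GeneralizedGamma

namespace EGG

variable (H : EGG) {σ ρ : ℝ} {r : ℕ}

lemma one_sub_w_pos : 0 < 1 - H.w := sub_pos.mpr H.w_lt_one

lemma pdf_eq_mixture (x : ℝ) :
    H.pdf x = H.w * generalizedGammaPDF 1 H.lam 1 x
      + (1 - H.w) * generalizedGammaPDF H.a H.b H.c x := by
  simp only [pdf, generalizedGammaPDF, mul_one, Real.rpow_one, Real.Gamma_one, sub_self,
    Real.rpow_zero, neg_div]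
  ring

lemma law_eq :
    H.law = (volume.restrict (Ioi 0)).withDensity fun x => ENNReal.ofReal (H.pdf x) := rfl

lemma measurable_pdf : Measurable H.pdf := by
  unfold pdf
  fun_prop

lemma pdf_nonneg {x : ℝ} (hx : 0 < x) : 0 ≤ H.pdf x := by
  rw [pdf_eq_mixture]
  exact add_nonneg
    (mul_nonneg H.w_pos.le (generalizedGammaPDF_nonneg one_pos H.lam_pos one_pos hx.le))
    (mul_nonneg H.one_sub_w_pos.le (generalizedGammaPDF_nonneg H.a_pos H.b_pos H.c_pos hx.le))

/-- The exponent of the EGG distribution function at `0`, so that `H.order r = H.exponent / r`. -/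
def exponent : ℝ := min 1 (H.a * H.c)

lemma exponent_pos : 0 < H.exponent := lt_min one_pos (mul_pos H.a_pos H.c_pos)

lemma exponent_le_one : H.exponent ≤ 1 := min_le_left _ _

lemma exponent_le_mul : H.exponent ≤ H.a * H.c := min_le_right _ _

/-- The coefficient of `x ^ H.exponent` in the EGG distribution function at `0`. As
`0 ^ 0 = 1`, it collects the components of the mixture whose exponent is `H.exponent`. -/
def coeff : ℝ :=
  H.w * (0 ^ (1 - H.exponent) / H.lam)
    + (1 - H.w) * (0 ^ (H.a * H.c - H.exponent) / (H.b ^ (H.a * H.c) * Real.Gamma (H.a + 1)))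

lemma coeff_of_mul_lt_one (h : H.a * H.c < 1) :
    H.coeff = (1 - H.w) / (H.b ^ (H.a * H.c) * Real.Gamma (H.a + 1)) := by
  have he : H.exponent = H.a * H.c := min_eq_right h.le
  rw [coeff, he, sub_self, Real.rpow_zero, Real.zero_rpow (sub_pos.mpr h).ne']
  ring

lemma coeff_pos : 0 < H.coeff := by
  have := H.w_pos; have := H.one_sub_w_pos; have := H.lam_pos; have := H.b_pos
  have := Real.Gamma_pos_of_pos (add_pos H.a_pos one_pos)
  rcases lt_or_ge (H.a * H.c) 1 with h | h
  · rw [H.coeff_of_mul_lt_one h]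
    positivity
  · have he : H.exponent = 1 := min_eq_left h
    rw [coeff, he, sub_self, Real.rpow_zero]
    positivity

lemma exists_pdf_le : ∃ D, ∀ x, 0 < x → H.pdf x ≤ D * x ^ (H.exponent - 1) := by
  obtain ⟨D₁, h₁⟩ := exists_generalizedGammaPDF_le (α := H.exponent) one_pos H.lam_pos one_pos
    (by simpa using H.exponent_le_one)
  obtain ⟨D₂, h₂⟩ := exists_generalizedGammaPDF_le H.a_pos H.b_pos H.c_pos H.exponent_le_mul
  refine ⟨H.w * D₁ + (1 - H.w) * D₂, fun x hx => ?_⟩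
  rw [pdf_eq_mixture, add_mul, mul_assoc, mul_assoc]
  exact add_le_add (mul_le_mul_of_nonneg_left (h₁ x hx) H.w_pos.le)
    (mul_le_mul_of_nonneg_left (h₂ x hx) H.one_sub_w_pos.le)

lemma tendsto_pdf_div_rpow :
    Tendsto (fun x => H.pdf x / x ^ (H.exponent - 1)) (𝓝[>] 0) (𝓝 (H.exponent * H.coeff)) := by
  have h₁ := tendsto_generalizedGammaPDF_div_rpow (α := H.exponent) one_pos H.lam_pos one_pos
    (by simpa using H.exponent_le_one)
  have h₂ := tendsto_generalizedGammaPDF_div_rpow H.a_pos H.b_pos H.c_pos H.exponent_le_mul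
  convert (h₁.const_mul H.w).add (h₂.const_mul (1 - H.w)) using 2 with x
  · rw [pdf_eq_mixture]
    ring
  · simp only [coeff, mul_one, Real.rpow_one, one_add_one_eq_two, Real.Gamma_two]
    ring

/-- The moment of order `-σ` of the EGG distribution if `σ < H.exponent`, and its analytic
continuation, which enters the coefficients of `productExpansion`, for other values of `σ`. -/
def negMoment (σ : ℝ) : ℝ :=
  H.w / H.lam ^ σ * Real.Gamma (1 - σ)
    + (1 - H.w) / (Real.Gamma H.a * H.b ^ σ) * Real.Gamma (H.a - σ / H.c)

lemma integral_rpow_neg_law (hσ : σ < H.exponent) : ∫ x, x ^ (-σ) ∂H.law = H.negMoment σ := by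
  have hσ₁ : σ < 1 * 1 := by simpa using hσ.trans_le H.exponent_le_one
  have hσ₂ : σ < H.a * H.c := hσ.trans_le H.exponent_le_mul
  have i₁ := integrableOn_generalizedGammaPDF_mul_rpow_neg H.lam_pos one_pos hσ₁
  have i₂ := integrableOn_generalizedGammaPDF_mul_rpow_neg H.b_pos H.c_pos hσ₂
  rw [integral_of_eq_withDensity H.law_eq H.measurable_pdf (fun _ => H.pdf_nonneg)]
  simp only [pdf_eq_mixture, add_mul, mul_assoc]
  rw [integral_add (i₁.const_mul _) (i₂.const_mul _), integral_const_mul, integral_const_mul,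
    integral_generalizedGammaPDF_mul_rpow_neg H.lam_pos one_pos hσ₁,
    integral_generalizedGammaPDF_mul_rpow_neg H.b_pos H.c_pos hσ₂, negMoment, div_one,
    Real.Gamma_one]
  ring

instance : IsProbabilityMeasure H.law := by
  have h := H.integral_rpow_neg_law H.exponent_pos
  have hΓ := (Real.Gamma_pos_of_pos H.a_pos).ne'
  simp only [negMoment, neg_zero, Real.rpow_zero, integral_const, smul_eq_mul, mul_one, div_one,
    sub_zero, zero_div, Real.Gamma_one, div_mul_cancel₀ _ hΓ, add_sub_cancel] at h
  exact ⟨(ENNReal.toReal_eq_one_iff _).mp h⟩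

instance : IsProbabilityMeasure (H.law.map (· ^ r)) :=
  Measure.isProbabilityMeasure_map (by fun_prop)

lemma isPowerLawAtZero_map_pow (hr : r ≠ 0) :
    IsPowerLawAtZero (H.law.map (· ^ r)) (H.order r) H.coeff := by
  obtain ⟨D, hD⟩ := H.exists_pdf_le
  exact (IsPowerLawAtZero.of_density H.law_eq H.exponent_pos H.exponent_le_one H.coeff_pos
    H.measurable_pdf (fun _ => H.pdf_nonneg) hD H.tendsto_pdf_div_rpow).map_pow hr

lemma integral_rpow_neg_map_pow (hρ : r * ρ < H.exponent) :
    ∫ x, x ^ (-ρ) ∂H.law.map (· ^ r) = H.negMoment (r * ρ) := by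
  rw [← H.integral_rpow_neg_law hρ, integral_map (by fun_prop) (by fun_prop)]
  refine integral_congr_ae ?_
  filter_upwards [ae_pos_of_eq_withDensity H.law_eq] with x hx
  rw [← Real.rpow_natCast, ← Real.rpow_mul hx.le, mul_neg]

end EGG

/-! ### High-SNR expansions -/

section Expansion

lemma EGG.order_pos (H : EGG) {r : ℕ} (hr : r ≠ 0) : 0 < H.order r :=
  div_pos H.exponent_pos (Nat.cast_pos.mpr hr.bot_lt)

lemma EGG.order_le_div (H : EGG) (r : ℕ) {e : ℝ} (he : H.exponent ≤ e) : H.order r ≤ e / r :=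
  div_le_div_of_nonneg_right he (Nat.cast_nonneg r)

/-- The terms of `cdfHighSNR` contributed by the first hop, at the inverse SNR `s`. The power
`x ^ e` of the threshold is replaced by a quantity `m e`, so as to have the expression itself and
its averages over the threshold in the same form. -/
def EGG.cdfExpansion (H : EGG) (r : ℕ) (m : ℝ → ℝ) (s : ℝ) : ℝ :=
  H.w / H.lam * (m (1 / r) * s ^ (1 / r : ℝ))
    + (1 - H.w) / (H.b ^ (H.a * H.c) * Real.Gamma (H.a + 1))
      * (m (H.a * H.c / r) * s ^ (H.a * H.c / r))

/-- The terms of `cdfHighSNR` contributed by the product of the two hops, at the product `s` of the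
inverse SNRs; `m` is as in `EGG.cdfExpansion`. -/
def productExpansion (H₁ H₂ : EGG) (r₁ r₂ : ℕ) (m : ℝ → ℝ) (s : ℝ) : ℝ :=
  H₂.w / H₂.lam * ((1 - H₁.w) / (Real.Gamma H₁.a * H₁.b ^ (r₁ / r₂ : ℝ))
      * Real.Gamma (H₁.a - r₁ / r₂ / H₁.c)) * (m (1 / r₂) * s ^ (1 / r₂ : ℝ))
    + (1 - H₂.w) / (H₂.b ^ (H₂.a * H₂.c) * Real.Gamma (H₂.a + 1))
      * H₁.negMoment (r₁ * (H₂.a * H₂.c / r₂))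
      * (m (H₂.a * H₂.c / r₂) * s ^ (H₂.a * H₂.c / r₂))

/-- The high-SNR expansion of the link at the inverse SNRs `s` of the first and `t` of the second
hop; `m` is as in `EGG.cdfExpansion`. -/
def highSNRExpansion (H₁ H₂ : EGG) (r₁ r₂ : ℕ) (m : ℝ → ℝ) (s t : ℝ) : ℝ :=
  H₁.cdfExpansion r₁ m s + productExpansion H₁ H₂ r₁ r₂ m (s * t)

section Integral

variable {τ : Measure ℝ} {e f : ℝ}

lemma integrable_add_rpow_terms (he : Integrable (fun u => u ^ e) τ)
    (hf : Integrable (fun u => u ^ f) τ) (A B s : ℝ) :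
    Integrable (fun u => A * (u ^ e * s ^ e) + B * (u ^ f * s ^ f)) τ :=
  ((he.mul_const _).const_mul A).add ((hf.mul_const _).const_mul B)

lemma integral_add_rpow_terms (he : Integrable (fun u => u ^ e) τ)
    (hf : Integrable (fun u => u ^ f) τ) (A B s : ℝ) :
    ∫ u, (A * (u ^ e * s ^ e) + B * (u ^ f * s ^ f)) ∂τ
      = A * ((∫ u, u ^ e ∂τ) * s ^ e) + B * ((∫ u, u ^ f ∂τ) * s ^ f) := by
  rw [integral_add ((he.mul_const _).const_mul A) ((hf.mul_const _).const_mul B),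
    integral_const_mul, integral_const_mul, integral_mul_const, integral_mul_const]

variable {H₁ H₂ : EGG} {r₁ r₂ : ℕ}

lemma EGG.integrable_cdfExpansion (hr₁ : r₁ ≠ 0)
    (hint : ∀ e : ℝ, 0 < e → Integrable (fun u => u ^ e) τ) (s : ℝ) :
    Integrable (fun u => H₁.cdfExpansion r₁ (fun e => u ^ e) s) τ := by
  have := H₁.a_pos; have := H₁.c_pos; have := Nat.pos_of_ne_zero hr₁
  exact integrable_add_rpow_terms (hint _ (by positivity)) (hint _ (by positivity)) _ _ s

lemma integrable_productExpansion (hr₂ : r₂ ≠ 0)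
    (hint : ∀ e : ℝ, 0 < e → Integrable (fun u => u ^ e) τ) (s : ℝ) :
    Integrable (fun u => productExpansion H₁ H₂ r₁ r₂ (fun e => u ^ e) s) τ := by
  have := H₂.a_pos; have := H₂.c_pos; have := Nat.pos_of_ne_zero hr₂
  exact integrable_add_rpow_terms (hint _ (by positivity)) (hint _ (by positivity)) _ _ s

lemma integrable_highSNRExpansion (hr₁ : r₁ ≠ 0) (hr₂ : r₂ ≠ 0)
    (hint : ∀ e : ℝ, 0 < e → Integrable (fun u => u ^ e) τ) (s t : ℝ) :
    Integrable (fun u => highSNRExpansion H₁ H₂ r₁ r₂ (fun e => u ^ e) s t) τ :=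
  (EGG.integrable_cdfExpansion hr₁ hint s).add (integrable_productExpansion hr₂ hint (s * t))

lemma integral_highSNRExpansion (hr₁ : r₁ ≠ 0) (hr₂ : r₂ ≠ 0)
    (hint : ∀ e : ℝ, 0 < e → Integrable (fun u => u ^ e) τ) (s t : ℝ) :
    ∫ u, highSNRExpansion H₁ H₂ r₁ r₂ (fun e => u ^ e) s t ∂τ
      = highSNRExpansion H₁ H₂ r₁ r₂ (fun e => ∫ u, u ^ e ∂τ) s t := by
  have := H₁.a_pos; have := H₁.c_pos; have := H₂.a_pos; have := H₂.c_pos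
  have := Nat.pos_of_ne_zero hr₁; have := Nat.pos_of_ne_zero hr₂
  simp only [highSNRExpansion]
  rw [integral_add (EGG.integrable_cdfExpansion hr₁ hint s)
    (integrable_productExpansion hr₂ hint (s * t))]
  congr 1 <;>
    exact integral_add_rpow_terms (hint _ (by positivity)) (hint _ (by positivity)) _ _ _

end Integral

section ClosedForm

variable {C μ₁ μ₂ b x e : ℝ} {r : ℕ}

lemma mul_div_pow_rpow_div {y : ℝ} (hr : r ≠ 0) (hx : 0 ≤ x) (hy : 0 ≤ y) (hb : 0 < b) (e : ℝ) :
    (x * y / b ^ r) ^ (e / r) = x ^ (e / r) * y ^ (e / r) / b ^ e := by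
  rw [Real.div_rpow (mul_nonneg hx hy) (by positivity), Real.mul_rpow hx hy, ← Real.rpow_natCast,
    ← Real.rpow_mul hb.le, mul_div_cancel₀ _ (Nat.cast_ne_zero.mpr hr)]

lemma div_pow_mul_rpow (hr : r ≠ 0) (hμ₁ : 0 < μ₁) (hb : 0 < b) (hx : 0 ≤ x) (e : ℝ) :
    (x / (b ^ r * μ₁)) ^ (e / r) = x ^ (e / r) * μ₁⁻¹ ^ (e / r) / b ^ e := by
  rw [← mul_div_pow_rpow_div hr hx (by positivity) hb]
  congr 1
  field_simp

lemma mul_div_pow_mul_rpow (hr : r ≠ 0) (hC : 0 < C) (hμ₁ : 0 < μ₁) (hμ₂ : 0 < μ₂) (hb : 0 < b)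
    (hx : 0 ≤ x) (e : ℝ) :
    (C * x / (b ^ r * μ₁ * μ₂)) ^ (e / r)
      = x ^ (e / r) * (μ₁⁻¹ * (C / μ₂)) ^ (e / r) / b ^ e := by
  rw [← mul_div_pow_rpow_div hr hx (by positivity) hb]
  congr 1
  field_simp

lemma mul_div_pow_mul_pow_mul_rpow {lam : ℝ} {r₂ : ℕ} (hr₂ : r₂ ≠ 0) (hC : 0 < C) (hμ₁ : 0 < μ₁)
    (hμ₂ : 0 < μ₂) (hb : 0 < b) (hlam : 0 < lam) (hx : 0 ≤ x) (r : ℕ) :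
    (C * x / (b ^ r * lam ^ r₂ * μ₁ * μ₂)) ^ (1 / r₂ : ℝ)
      = x ^ (1 / r₂ : ℝ) * (μ₁⁻¹ * (C / μ₂)) ^ (1 / r₂ : ℝ) / (b ^ (r / r₂ : ℝ) * lam) := by
  have hpow : b ^ r * lam ^ r₂ = (b ^ (r / r₂ : ℝ) * lam) ^ r₂ := by
    rw [mul_pow, ← Real.rpow_mul_natCast hb.le, div_mul_cancel₀ _ (Nat.cast_ne_zero.mpr hr₂),
      Real.rpow_natCast]
  rw [hpow, mul_div_pow_mul_rpow hr₂ hC hμ₁ hμ₂ (by positivity) hx, Real.rpow_one]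

lemma EGG.negMoment_mul_div (H : EGG) (r₁ a c r₂ : ℝ) :
    H.negMoment (r₁ * (a * c / r₂))
      = H.w / H.lam ^ (r₁ * a * c / r₂) * Real.Gamma (1 - r₁ * a * c / r₂)
        + (1 - H.w) / (Real.Gamma H.a * H.b ^ (r₁ * a * c / r₂))
          * Real.Gamma (H.a - r₁ * a * c / (H.c * r₂)) := by
  rw [negMoment, show r₁ * (a * c / r₂) = r₁ * a * c / r₂ by ring, div_div, mul_comm r₂]

variable {r₁ r₂ : ℕ} (H₁ H₂ : EGG)

lemma cdfHighSNR_eq (hr₁ : r₁ ≠ 0) (hr₂ : r₂ ≠ 0) (hC : 0 < C) (hμ₁ : 0 < μ₁) (hμ₂ : 0 < μ₂)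
    (hx : 0 ≤ x) :
    cdfHighSNR H₁ H₂ r₁ r₂ C μ₁ μ₂ x
      = highSNRExpansion H₁ H₂ r₁ r₂ (fun e => x ^ e) μ₁⁻¹ (C / μ₂) := by
  rw [cdfHighSNR, div_pow_mul_rpow hr₁ hμ₁ H₁.lam_pos hx, div_pow_mul_rpow hr₁ hμ₁ H₁.b_pos hx,
    mul_div_pow_mul_pow_mul_rpow hr₂ hC hμ₁ hμ₂ H₁.b_pos H₂.lam_pos hx,
    mul_div_pow_mul_rpow hr₂ hC hμ₁ hμ₂ H₂.b_pos hx, ← EGG.negMoment_mul_div, Real.rpow_one,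
    highSNRExpansion, EGG.cdfExpansion, productExpansion, div_div (r₁ : ℝ), mul_comm (r₂ : ℝ)]
  ring

variable (M : Modulation)

lemma Modulation.berHighSNR_eq (hr₁ : r₁ ≠ 0) (hr₂ : r₂ ≠ 0) (hC : 0 < C) (hμ₁ : 0 < μ₁)
    (hμ₂ : 0 < μ₂) :
    M.berHighSNR H₁ H₂ r₁ r₂ C μ₁ μ₂
      = M.δ / 2 * ∑ k, highSNRExpansion H₁ H₂ r₁ r₂
          (fun e => ∫ u, u ^ e ∂gammaMeasure M.p (M.q k)) μ₁⁻¹ (C / μ₂) := by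
  have := M.p_pos; have := H₁.a_pos; have := H₁.c_pos; have := H₂.a_pos; have := H₂.c_pos
  have := Nat.pos_of_ne_zero hr₁; have := Nat.pos_of_ne_zero hr₂
  simp only [Modulation.berHighSNR, Finset.mul_sum, ← Finset.sum_add_distrib]
  refine Finset.sum_congr rfl fun k _ => ?_
  have hq := M.q_pos k
  have hmoment : ∀ e, 0 < e → ∫ u, u ^ e ∂gammaMeasure M.p (M.q k)
      = Real.Gamma (M.p + e) / Real.Gamma M.p * (M.q k)⁻¹ ^ e := fun e he => by
    rw [integral_rpow_gammaMeasure M.p_pos (by positivity) hq, Real.inv_rpow hq.le,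
      Real.rpow_neg hq.le]
  have hinv : ∀ A B : ℝ, A / (M.q k * B) = A * (M.q k)⁻¹ / B := fun A B => by
    rw [← div_div, div_eq_mul_inv A]
  simp only [mul_assoc (M.q k), hinv, one_mul]
  rw [div_pow_mul_rpow hr₁ hμ₁ H₁.lam_pos (by positivity),
    div_pow_mul_rpow hr₁ hμ₁ H₁.b_pos (by positivity),
    mul_div_pow_mul_pow_mul_rpow hr₂ hC hμ₁ hμ₂ H₁.b_pos H₂.lam_pos (by positivity),
    mul_div_pow_mul_rpow hr₂ hC hμ₁ hμ₂ H₂.b_pos (by positivity), ← EGG.negMoment_mul_div,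
    Real.rpow_one, highSNRExpansion, EGG.cdfExpansion, productExpansion, div_div (r₁ : ℝ),
    mul_comm (r₂ : ℝ), hmoment _ (by positivity), hmoment _ (by positivity),
    hmoment _ (by positivity), hmoment _ (by positivity)]
  ring

end ClosedForm

end Expansion

section Asymptotics

lemma isLittleO_rpow_terms_sub (m : ℝ → ℝ) {a e : ℝ} (hae : a ≤ e) {r : ℕ} (hr : r ≠ 0) (A : ℝ) :
    (fun s : ℝ => A * (m (e / r) * s ^ (e / r)) - A * 0 ^ (e - a) * (m (a / r) * s ^ (a / r)))
      =o[𝓝[>] 0] fun s => s ^ (a / r) := by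
  rcases hae.eq_or_lt with rfl | hae
  · simp
  · have hlt : a / r < e / r := div_lt_div_of_pos_right hae (Nat.cast_pos.mpr hr.bot_lt)
    simpa [Real.zero_rpow (sub_pos.mpr hae).ne', mul_assoc] using
      ((isLittleO_rpow_rpow_nhdsGT_zero hlt).const_mul_left (A * m (e / r)))

lemma EGG.cdfExpansion_isEquivalent (H : EGG) {r : ℕ} (hr : r ≠ 0) {m : ℝ → ℝ}
    (hm : 0 < m (H.order r)) :
    H.cdfExpansion r m ~[𝓝[>] 0] fun s => H.coeff * m (H.order r) * s ^ H.order r := by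
  refine IsLittleO.const_mul_right (mul_pos H.coeff_pos hm).ne' ?_
  refine ((isLittleO_rpow_terms_sub m H.exponent_le_one hr (H.w / H.lam)).add
    (isLittleO_rpow_terms_sub m H.exponent_le_mul hr
      ((1 - H.w) / (H.b ^ (H.a * H.c) * Real.Gamma (H.a + 1))))).congr_left fun s => ?_
  simp only [Pi.sub_apply, cdfExpansion, coeff, show H.order r = H.exponent / r from rfl]
  ring

variable {H₁ H₂ : EGG} {r₁ r₂ : ℕ} {m : ℝ → ℝ}

lemma productExpansion_isEquivalent (hr₁ : r₁ ≠ 0) (hr₂ : r₂ ≠ 0)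
    (hm : 0 < m (H₂.order r₂)) (h : H₂.order r₂ < H₁.order r₁) (hac : H₂.a * H₂.c < 1) :
    productExpansion H₁ H₂ r₁ r₂ m ~[𝓝[>] 0] fun s =>
      H₂.coeff * (m (H₂.order r₂) * ∫ x, x ^ (-H₂.order r₂) ∂H₁.law.map (· ^ r₁))
        * s ^ H₂.order r₂ := by
  have hr₁' : (0 : ℝ) < r₁ := Nat.cast_pos.mpr hr₁.bot_lt
  have hr₂' : (0 : ℝ) < r₂ := Nat.cast_pos.mpr hr₂.bot_lt
  have hmoment := (H₁.isPowerLawAtZero_map_pow hr₁).integral_rpow_neg_pos (H₂.order_pos hr₂) h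
  have horder : H₂.order r₂ = H₂.a * H₂.c / r₂ := by rw [EGG.order, min_eq_right hac.le]
  have hlt : H₂.order r₂ < 1 / r₂ := horder.trans_lt (div_lt_div_of_pos_right hac hr₂')
  refine IsLittleO.const_mul_right (mul_pos H₂.coeff_pos (mul_pos hm hmoment)).ne' ?_
  refine ((isLittleO_rpow_rpow_nhdsGT_zero hlt).const_mul_left (H₂.w / H₂.lam
    * ((1 - H₁.w) / (Real.Gamma H₁.a * H₁.b ^ (r₁ / r₂ : ℝ)) * Real.Gamma (H₁.a - r₁ / r₂ / H₁.c))
    * m (1 / r₂))).congr_left fun s => ?_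
  rw [Pi.sub_apply, H₁.integral_rpow_neg_map_pow ((lt_div_iff₀' hr₁').mp h),
    H₂.coeff_of_mul_lt_one hac, productExpansion, horder]
  ring

variable {ι : Type*} {l : Filter ι} {s t : ι → ℝ}

lemma highSNRExpansion_isEquivalent (hr₁ : r₁ ≠ 0) (hm : 0 < m (H₁.order r₁))
    (hs : Tendsto s l (𝓝[>] 0))
    (h₁ : (fun i => (s i * t i) ^ (1 / r₂ : ℝ)) =o[l] fun i => s i ^ H₁.order r₁)
    (h₂ : (fun i => (s i * t i) ^ (H₂.a * H₂.c / r₂)) =o[l] fun i => s i ^ H₁.order r₁) :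
    (fun i => highSNRExpansion H₁ H₂ r₁ r₂ m (s i) (t i)) ~[l]
      fun i => H₁.coeff * m (H₁.order r₁) * s i ^ H₁.order r₁ := by
  have hproduct : (fun i => productExpansion H₁ H₂ r₁ r₂ m (s i * t i)) =o[l]
      fun i => s i ^ H₁.order r₁ :=
    ((h₁.const_mul_left _).const_mul_left _).add ((h₂.const_mul_left _).const_mul_left _)
  exact ((H₁.cdfExpansion_isEquivalent hr₁ hm).comp_tendsto hs).add_isLittleO
    (hproduct.const_mul_right (mul_pos H₁.coeff_pos hm).ne')

lemma highSNRExpansion_isEquivalent_add (hr₁ : r₁ ≠ 0) (hr₂ : r₂ ≠ 0)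
    (hm₁ : 0 < m (H₁.order r₁)) (hm₂ : 0 < m (H₂.order r₂)) (h : H₂.order r₂ < H₁.order r₁)
    (hac : H₂.a * H₂.c < 1) (hs : Tendsto s l (𝓝[>] 0)) (ht : Tendsto t l (𝓝[>] 0)) :
    (fun i => highSNRExpansion H₁ H₂ r₁ r₂ m (s i) (t i)) ~[l]
      fun i => H₁.coeff * m (H₁.order r₁) * s i ^ H₁.order r₁
        + H₂.coeff * (m (H₂.order r₂) * ∫ x, x ^ (-H₂.order r₂) ∂H₁.law.map (· ^ r₁))
          * (s i * t i) ^ H₂.order r₂ := by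
  have hst := tendsto_mul_nhdsGT_zero hs ht
  refine isEquivalent_add_of_nonneg ((H₁.cdfExpansion_isEquivalent hr₁ hm₁).comp_tendsto hs)
    ((productExpansion_isEquivalent hr₁ hr₂ hm₂ h hac).comp_tendsto hst) ?_ ?_
  · filter_upwards [hs.eventually self_mem_nhdsWithin] with i (hsi : 0 < s i)
    exact mul_nonneg (mul_pos H₁.coeff_pos hm₁).le (by positivity)
  · filter_upwards [hst.eventually self_mem_nhdsWithin] with i (hsti : 0 < s i * t i)
    have hmoment := (H₁.isPowerLawAtZero_map_pow hr₁).integral_rpow_neg_pos (H₂.order_pos hr₂) h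
    exact mul_nonneg (mul_pos H₂.coeff_pos (mul_pos hm₂ hmoment)).le (Real.rpow_nonneg hsti.le _)

variable {τ : Measure ℝ} [IsProbabilityMeasure τ]

lemma isLittleO_productAverage_of_order_le (hr₁ : r₁ ≠ 0) (hr₂ : r₂ ≠ 0) (hτ : ∀ᵐ u ∂τ, 0 < u)
    (hτα : Integrable (fun u => u ^ H₁.order r₁) τ)
    (hs : Tendsto s l (𝓝[>] 0)) (ht : Tendsto t l (𝓝[>] 0)) (hle : H₁.order r₁ ≤ H₂.order r₂)
    (hlog : H₁.order r₁ = H₂.order r₂ →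
      (fun i => Real.log (s i)) =o[l] fun i => t i ^ (-H₁.order r₁)) :
    (fun i => productAverage τ (H₁.law.map (· ^ r₁)) (H₂.law.map (· ^ r₂)) (s i * t i)) =o[l]
      fun i => s i ^ H₁.order r₁ := by
  have h₁ := H₁.isPowerLawAtZero_map_pow hr₁
  have h₂ := H₂.isPowerLawAtZero_map_pow hr₂
  rcases hle.eq_or_lt with heq | hlt
  · rw [← heq] at h₂
    exact isLittleO_productAverage_of_log hτ hτα h₁ h₂ hs ht (hlog heq)
  · exact isLittleO_productAverage_of_lt hτ hτα h₁ h₂ hlt hs ht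

lemma isLittleO_productAverage_of_order_lt (hr₁ : r₁ ≠ 0) (hr₂ : r₂ ≠ 0) (hτ : ∀ᵐ u ∂τ, 0 < u)
    (hτβ : Integrable (fun u => u ^ H₂.order r₂) τ)
    (hs : Tendsto s l (𝓝[>] 0)) (ht : Tendsto t l (𝓝[>] 0)) (hlt : H₂.order r₂ < H₁.order r₁)
    (hst : (fun i => (s i * t i) ^ H₂.order r₂) =o[l] fun i => s i ^ H₁.order r₁) :
    (fun i => productAverage τ (H₁.law.map (· ^ r₁)) (H₂.law.map (· ^ r₂)) (s i * t i)) =o[l]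
      fun i => s i ^ H₁.order r₁ :=
  (((productAverage_isEquivalent hτ hτβ (H₁.isPowerLawAtZero_map_pow hr₁)
    (H₂.isPowerLawAtZero_map_pow hr₂) hlt).comp_tendsto
      (tendsto_mul_nhdsGT_zero hs ht)).isBigO.trans
        (isBigO_const_mul_self _ _ _)).trans_isLittleO hst

lemma relayAverage_isEquivalent_highSNRExpansion_of_isLittleO (hr₁ : r₁ ≠ 0) (hr₂ : r₂ ≠ 0)
    (hτ : ∀ᵐ u ∂τ, 0 < u) (hτα : Integrable (fun u => u ^ H₁.order r₁) τ)
    (hs : Tendsto s l (𝓝[>] 0)) (ht : Tendsto t l (𝓝[>] 0))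
    (hpow : ∀ e, H₂.exponent ≤ e →
      (fun i => (s i * t i) ^ (e / r₂)) =o[l] fun i => s i ^ H₁.order r₁)
    (hprod : (fun i => productAverage τ (H₁.law.map (· ^ r₁)) (H₂.law.map (· ^ r₂)) (s i * t i))
      =o[l] fun i => s i ^ H₁.order r₁) :
    (fun i => relayAverage τ (H₁.law.map (· ^ r₁)) (H₂.law.map (· ^ r₂)) (s i) (t i)) ~[l]
      fun i => highSNRExpansion H₁ H₂ r₁ r₂ (fun e => ∫ u, u ^ e ∂τ) (s i) (t i) :=
  (relayAverage_isEquivalent hτ hτα (H₁.isPowerLawAtZero_map_pow hr₁)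
    (H₂.isPowerLawAtZero_map_pow hr₂).ae_pos hs ht hprod).trans
    (highSNRExpansion_isEquivalent (m := fun e => ∫ u, u ^ e ∂τ) hr₁ (integral_rpow_pos hτ hτα) hs
      (hpow 1 H₂.exponent_le_one) (hpow _ H₂.exponent_le_mul)).symm

theorem relayAverage_isEquivalent_highSNRExpansion (hr₁ : r₁ ≠ 0) (hr₂ : r₂ ≠ 0)
    (hτ : ∀ᵐ u ∂τ, 0 < u) (hint : ∀ e : ℝ, 0 < e → Integrable (fun u => u ^ e) τ)
    (hs : Tendsto s l (𝓝[>] 0)) (ht : Tendsto t l (𝓝[>] 0))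
    (hlog : H₁.order r₁ = H₂.order r₂ →
      (fun i => Real.log (s i)) =o[l] fun i => t i ^ (-H₁.order r₁))
    (hexp : 1 ≤ H₂.a * H₂.c → 1 / r₂ < H₁.order r₁ →
      (fun i => (s i * t i) ^ (1 / r₂ : ℝ)) =o[l] fun i => s i ^ H₁.order r₁) :
    (fun i => relayAverage τ (H₁.law.map (· ^ r₁)) (H₂.law.map (· ^ r₂)) (s i) (t i)) ~[l]
      fun i => highSNRExpansion H₁ H₂ r₁ r₂ (fun e => ∫ u, u ^ e ∂τ) (s i) (t i) := by
  have hα := hint _ (H₁.order_pos hr₁)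
  have hβ := hint _ (H₂.order_pos hr₂)
  rcases le_or_gt (H₁.order r₁) (H₂.order r₂) with hle | hlt
  · refine relayAverage_isEquivalent_highSNRExpansion_of_isLittleO hr₁ hr₂ hτ hα hs ht
      (fun e he => ?_) (isLittleO_productAverage_of_order_le hr₁ hr₂ hτ hα hs ht hle hlog)
    have hle' := hle.trans (H₂.order_le_div r₂ he)
    exact isLittleO_mul_rpow ((H₁.order_pos hr₁).trans_le hle') hle' hs ht
  rcases lt_or_ge (H₂.a * H₂.c) 1 with hac | hac
  · exact (relayAverage_isEquivalent_add hτ hα hβ (H₁.isPowerLawAtZero_map_pow hr₁)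
      (H₂.isPowerLawAtZero_map_pow hr₂) hlt hs ht).trans
      (highSNRExpansion_isEquivalent_add (m := fun e => ∫ u, u ^ e ∂τ) hr₁ hr₂
        (integral_rpow_pos hτ hα) (integral_rpow_pos hτ hβ) hlt hac hs ht).symm
  · have horder : H₂.order r₂ = 1 / r₂ := by rw [EGG.order, min_eq_left hac]
    have hst : (fun i => (s i * t i) ^ H₂.order r₂) =o[l] fun i => s i ^ H₁.order r₁ := by
      rw [horder] at hlt ⊢
      exact hexp hac hlt
    exact relayAverage_isEquivalent_highSNRExpansion_of_isLittleO hr₁ hr₂ hτ hα hs ht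
      (fun e he => ((isBigO_rpow_rpow_nhdsGT_zero (H₂.order_le_div r₂ he)).comp_tendsto
        (tendsto_mul_nhdsGT_zero hs ht)).trans_isLittleO hst)
      (isLittleO_productAverage_of_order_lt hr₁ hr₂ hτ hβ hs ht hlt hst)

end Asymptotics

/-! ### The dual-hop link -/

section EndToEnd

variable {r₁ r₂ : ℕ} {C μ₁ μ₂ : ℝ}

lemma measurable_endSNR (r₁ r₂ : ℕ) (C μ₁ μ₂ : ℝ) :
    Measurable fun z : ℝ × ℝ => endSNR r₁ r₂ C μ₁ μ₂ z.1 z.2 := by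
  unfold endSNR hopSNR
  fun_prop

lemma endSNR_nonneg (hC : 0 ≤ C) (hμ₁ : 0 ≤ μ₁) (hμ₂ : 0 ≤ μ₂) {x y : ℝ} (hx : 0 ≤ x)
    (hy : 0 ≤ y) : 0 ≤ endSNR r₁ r₂ C μ₁ μ₂ x y := by
  unfold endSNR hopSNR
  positivity

lemma endSNR_le_iff (hC : 0 < C) (hμ₁ : 0 < μ₁) (hμ₂ : 0 < μ₂) {y : ℝ} (hy : 0 < y) (x u : ℝ) :
    endSNR r₁ r₂ C μ₁ μ₂ x y ≤ u ↔ x ^ r₁ ≤ μ₁⁻¹ * u * (1 + C / μ₂ / y ^ r₂) := by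
  have hthreshold : μ₁⁻¹ * u * (1 + C / μ₂ / y ^ r₂)
      = u * (μ₂ * y ^ r₂ + C) / (μ₁ * (μ₂ * y ^ r₂)) := by
    field_simp
  rw [endSNR, hopSNR, hopSNR, div_le_iff₀ (by positivity), hthreshold, le_div_iff₀ (by positivity),
    mul_comm μ₁, mul_assoc]

variable {Ω : Type*} [MeasurableSpace Ω] {P : Measure Ω} {I₁ I₂ : Ω → ℝ}

lemma aemeasurable_endSNR (hI₁ : AEMeasurable I₁ P) (hI₂ : AEMeasurable I₂ P) :
    AEMeasurable (fun o => endSNR r₁ r₂ C μ₁ μ₂ (I₁ o) (I₂ o)) P :=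
  (measurable_endSNR r₁ r₂ C μ₁ μ₂).comp_aemeasurable (hI₁.prodMk hI₂)

lemma EGG.ae_pos_of_hasLaw {H : EGG} {X : Ω → ℝ} (hX : HasLaw X H.law P) : ∀ᵐ o ∂P, 0 < X o := by
  have h := ae_pos_of_eq_withDensity H.law_eq
  rw [← hX.map_eq] at h
  exact ae_of_ae_map hX.aemeasurable h

variable [IsProbabilityMeasure P]

section Laws

variable {ν₁ ν₂ : Measure ℝ} [IsProbabilityMeasure ν₁] [IsProbabilityMeasure ν₂]

lemma cdfOf_endSNR (hI₁ : HasLaw I₁ ν₁ P) (hI₂ : HasLaw I₂ ν₂ P) (hI : IndepFun I₁ I₂ P)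
    (hν₂ : ∀ᵐ y ∂ν₂, 0 < y) (hC : 0 < C) (hμ₁ : 0 < μ₁) (hμ₂ : 0 < μ₂) (u : ℝ) :
    cdfOf P (fun o => endSNR r₁ r₂ C μ₁ μ₂ (I₁ o) (I₂ o)) u
      = ∫ y, cdf (ν₁.map (· ^ r₁)) (μ₁⁻¹ * u * (1 + C / μ₂ / y)) ∂ν₂.map (· ^ r₂) := by
  have := Measure.isProbabilityMeasure_map (μ := ν₁) (f := (· ^ r₁)) (by fun_prop)
  have hset : MeasurableSet {z : ℝ × ℝ | endSNR r₁ r₂ C μ₁ μ₂ z.1 z.2 ≤ u} :=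
    measurable_endSNR r₁ r₂ C μ₁ μ₂ measurableSet_Iic
  have hlaw := ((indepFun_iff_hasLaw_prodMk_prod hI₁ hI₂).mp hI).measureReal_eq hset
  have hmeas : Measurable fun y => cdf (ν₁.map (· ^ r₁)) (μ₁⁻¹ * u * (1 + C / μ₂ / y)) :=
    (measurable_cdf _).comp (by fun_prop)
  rw [cdfOf, hlaw, measureReal_prod_eq_integral_symm _ _ hset,
    integral_map (by fun_prop) hmeas.aestronglyMeasurable]
  refine integral_congr_ae (hν₂.mono fun y hy => ?_)
  simp only [mem_ofPred_eq, endSNR_le_iff hC hμ₁ hμ₂ hy]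
  rw [cdf_eq_real, map_measureReal_apply (by fun_prop) measurableSet_Iic]
  rfl

lemma integral_cdfOf_endSNR {τ : Measure ℝ} [IsProbabilityMeasure τ] (hI₁ : HasLaw I₁ ν₁ P)
    (hI₂ : HasLaw I₂ ν₂ P) (hI : IndepFun I₁ I₂ P) (hν₂ : ∀ᵐ y ∂ν₂, 0 < y) (hC : 0 < C)
    (hμ₁ : 0 < μ₁) (hμ₂ : 0 < μ₂) :
    ∫ u, cdfOf P (fun o => endSNR r₁ r₂ C μ₁ μ₂ (I₁ o) (I₂ o)) u ∂τ
      = relayAverage τ (ν₁.map (· ^ r₁)) (ν₂.map (· ^ r₂)) μ₁⁻¹ (C / μ₂) := by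
  have := Measure.isProbabilityMeasure_map (μ := ν₂) (f := (· ^ r₂)) (by fun_prop)
  simp only [cdfOf_endSNR hI₁ hI₂ hI hν₂ hC hμ₁ hμ₂]
  rw [relayAverage, integral_prod _ (integrable_cdf_comp _ (by fun_prop))]

end Laws

variable {H₁ H₂ : EGG}

variable (M : Modulation)

lemma Modulation.avgBER_endSNR_eq_berOfCDF (hI₁ : HasLaw I₁ H₁.law P) (hI₂ : HasLaw I₂ H₂.law P)
    (hC : 0 ≤ C) (hμ₁ : 0 ≤ μ₁) (hμ₂ : 0 ≤ μ₂) :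
    M.avgBER P (fun o => endSNR r₁ r₂ C μ₁ μ₂ (I₁ o) (I₂ o))
      = M.berOfCDF (cdfOf P fun o => endSNR r₁ r₂ C μ₁ μ₂ (I₁ o) (I₂ o)) := by
  refine M.avgBER_eq_berOfCDF (aemeasurable_endSNR hI₁.aemeasurable hI₂.aemeasurable) ?_
  filter_upwards [EGG.ae_pos_of_hasLaw hI₁, EGG.ae_pos_of_hasLaw hI₂] with o h₁ h₂
  exact endSNR_nonneg hC hμ₁ hμ₂ h₁.le h₂.le

lemma Modulation.avgBER_endSNR_eq (hI₁ : HasLaw I₁ H₁.law P) (hI₂ : HasLaw I₂ H₂.law P)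
    (hI : IndepFun I₁ I₂ P) (hC : 0 < C) (hμ₁ : 0 < μ₁) (hμ₂ : 0 < μ₂) :
    M.avgBER P (fun o => endSNR r₁ r₂ C μ₁ μ₂ (I₁ o) (I₂ o))
      = M.δ / 2 * ∑ k, relayAverage (gammaMeasure M.p (M.q k)) (H₁.law.map (· ^ r₁))
          (H₂.law.map (· ^ r₂)) μ₁⁻¹ (C / μ₂) := by
  rw [M.avgBER_endSNR_eq_berOfCDF hI₁ hI₂ hC.le hμ₁.le hμ₂.le, M.berOfCDF_eq]
  congr 1
  refine Finset.sum_congr rfl fun k _ => ?_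
  have := isProbabilityMeasure_gammaMeasure M.p_pos (M.q_pos k)
  exact integral_cdfOf_endSNR hI₁ hI₂ hI (ae_pos_of_eq_withDensity H₂.law_eq) hC hμ₁ hμ₂

section HighSNR

lemma Modulation.integrable_rpow_gammaMeasure (k : Fin M.n) {e : ℝ} (he : 0 < e) :
    Integrable (fun u => u ^ e) (gammaMeasure M.p (M.q k)) :=
  UWOC.integrable_rpow_gammaMeasure M.p_pos (add_pos M.p_pos he) (M.q_pos k)

lemma cdfHighSNR_ae_eq (hr₁ : r₁ ≠ 0) (hr₂ : r₂ ≠ 0) (hC : 0 < C) (hμ₁ : 0 < μ₁) (hμ₂ : 0 < μ₂)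
    {τ : Measure ℝ} (hτ : ∀ᵐ u ∂τ, 0 < u) :
    cdfHighSNR H₁ H₂ r₁ r₂ C μ₁ μ₂
      =ᵐ[τ] fun u => highSNRExpansion H₁ H₂ r₁ r₂ (fun e => u ^ e) μ₁⁻¹ (C / μ₂) :=
  hτ.mono fun _ hu => cdfHighSNR_eq H₁ H₂ hr₁ hr₂ hC hμ₁ hμ₂ hu.le

lemma Modulation.integrable_cdfHighSNR (hr₁ : r₁ ≠ 0) (hr₂ : r₂ ≠ 0) (hC : 0 < C)
    (hμ₁ : 0 < μ₁) (hμ₂ : 0 < μ₂) (k : Fin M.n) :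
    Integrable (cdfHighSNR H₁ H₂ r₁ r₂ C μ₁ μ₂) (gammaMeasure M.p (M.q k)) :=
  (integrable_highSNRExpansion hr₁ hr₂ (fun _ => M.integrable_rpow_gammaMeasure k) _ _).congr
    (cdfHighSNR_ae_eq hr₁ hr₂ hC hμ₁ hμ₂ (ae_pos_gammaMeasure _ _)).symm

lemma Modulation.berOfCDF_cdfHighSNR (hr₁ : r₁ ≠ 0) (hr₂ : r₂ ≠ 0) (hC : 0 < C) (hμ₁ : 0 < μ₁)
    (hμ₂ : 0 < μ₂) :
    M.berOfCDF (cdfHighSNR H₁ H₂ r₁ r₂ C μ₁ μ₂) = M.berHighSNR H₁ H₂ r₁ r₂ C μ₁ μ₂ := by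
  rw [M.berOfCDF_eq, M.berHighSNR_eq H₁ H₂ hr₁ hr₂ hC hμ₁ hμ₂]
  congr 1
  refine Finset.sum_congr rfl fun k _ => ?_
  rw [integral_congr_ae (cdfHighSNR_ae_eq hr₁ hr₂ hC hμ₁ hμ₂ (ae_pos_gammaMeasure _ _)),
    integral_highSNRExpansion hr₁ hr₂ fun _ => M.integrable_rpow_gammaMeasure k]

end HighSNR

section Limit

variable {l : Filter (ℝ × ℝ)} {α e : ℝ}

lemma isLittleO_log_inv (hC : 0 < C) (h₂ : Tendsto Prod.snd l atTop)
    (h : (fun μ : ℝ × ℝ => Real.log μ.1) =o[l] fun μ => μ.2 ^ α) :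
    (fun μ : ℝ × ℝ => Real.log μ.1⁻¹) =o[l] fun μ => (C / μ.2) ^ (-α) := by
  simp only [Real.log_inv, isLittleO_neg_left]
  refine (h.const_mul_right (c := C ^ (-α)) (by positivity)).congr' .rfl ?_
  filter_upwards [h₂.eventually_gt_atTop 0] with μ hμ
  rw [Real.div_rpow hC.le hμ.le, Real.rpow_neg hμ.le, div_inv_eq_mul]

lemma isLittleO_inv_mul_div_rpow (hC : 0 < C) (h₁ : Tendsto Prod.fst l atTop)
    (h₂ : Tendsto Prod.snd l atTop)
    (h : (fun μ : ℝ × ℝ => (μ.1 * μ.2) ^ (-e)) =o[l] fun μ => μ.1 ^ (-α)) :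
    (fun μ : ℝ × ℝ => (μ.1⁻¹ * (C / μ.2)) ^ e) =o[l] fun μ => μ.1⁻¹ ^ α := by
  refine (h.const_mul_left (C ^ e)).congr' ?_ ?_
  · filter_upwards [h₁.eventually_gt_atTop 0, h₂.eventually_gt_atTop 0] with μ hμ₁ hμ₂
    rw [inv_mul_eq_div, div_div, mul_comm μ.2, Real.div_rpow hC.le (by positivity),
      Real.rpow_neg (by positivity), div_eq_mul_inv]
  · filter_upwards [h₁.eventually_gt_atTop 0] with μ hμ
    rw [Real.inv_rpow hμ.le, Real.rpow_neg hμ.le]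

theorem Modulation.avgBER_isEquivalent_berHighSNR (hI₁ : HasLaw I₁ H₁.law P)
    (hI₂ : HasLaw I₂ H₂.law P) (hI : IndepFun I₁ I₂ P) (hr₁ : r₁ ≠ 0) (hr₂ : r₂ ≠ 0) (hC : 0 < C)
    (h₁ : Tendsto Prod.fst l atTop) (h₂ : Tendsto Prod.snd l atTop)
    (hlog : H₁.order r₁ = H₂.order r₂ →
      (fun μ : ℝ × ℝ => Real.log μ.1) =o[l] fun μ => μ.2 ^ H₁.order r₁)
    (hexp : 1 ≤ H₂.a * H₂.c → 1 / r₂ < H₁.order r₁ →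
      (fun μ : ℝ × ℝ => (μ.1 * μ.2) ^ (-(1 / r₂) : ℝ)) =o[l] fun μ => μ.1 ^ (-H₁.order r₁)) :
    (fun μ : ℝ × ℝ => M.avgBER P fun o => endSNR r₁ r₂ C μ.1 μ.2 (I₁ o) (I₂ o))
      ~[l] fun μ => M.berHighSNR H₁ H₂ r₁ r₂ C μ.1 μ.2 := by
  have hs : Tendsto (fun μ : ℝ × ℝ => μ.1⁻¹) l (𝓝[>] 0) := tendsto_inv_atTop_nhdsGT_zero.comp h₁
  have ht : Tendsto (fun μ : ℝ × ℝ => C / μ.2) l (𝓝[>] 0) := by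
    simpa only [Function.comp_def, inv_mul_eq_div] using
      (tendsto_mul_const_nhdsGT_zero hC).comp (tendsto_inv_atTop_nhdsGT_zero.comp h₂)
  have hterm : ∀ k : Fin M.n, _ := fun k =>
    have := isProbabilityMeasure_gammaMeasure M.p_pos (M.q_pos k)
    relayAverage_isEquivalent_highSNRExpansion hr₁ hr₂ (ae_pos_gammaMeasure M.p (M.q k))
      (fun _ => M.integrable_rpow_gammaMeasure k) hs ht
      (fun h => isLittleO_log_inv hC h₂ (hlog h))
      fun hac hlt => isLittleO_inv_mul_div_rpow hC h₁ h₂ (hexp hac hlt)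
  have hsum := isEquivalent_sum_of_nonneg (S := Finset.univ) (fun k _ => (hterm k).symm) fun k _ =>
    .of_forall fun μ => relayAverage_nonneg _ _ _ _ _
  refine ((IsEquivalent.refl (u := fun _ => M.δ / 2)).mul hsum.symm).congr_left ?_ |>.congr_right ?_
  all_goals
    filter_upwards [h₁.eventually_gt_atTop 0, h₂.eventually_gt_atTop 0] with μ hμ₁ hμ₂
  · exact (M.avgBER_endSNR_eq hI₁ hI₂ hI hC hμ₁ hμ₂).symm
  · exact (M.berHighSNR_eq H₁ H₂ hr₁ hr₂ hC hμ₁ hμ₂).symm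

end Limit

end EndToEnd

end UWOC

end

theorem mainTheorem7_general
    {Ω : Type*} [MeasurableSpace Ω] (P : Measure Ω) [IsProbabilityMeasure P]
    (H₁ H₂ : UWOC.EGG) (I₁ I₂ : Ω → ℝ)
    (hI₁ : HasLaw I₁ H₁.law P) (hI₂ : HasLaw I₂ H₂.law P) (hI : IndepFun I₁ I₂ P)
    (r₁ r₂ : ℕ) (hr₁ : r₁ ≠ 0) (hr₂ : r₂ ≠ 0)
    (C : ℝ) (hC : 0 < C) (M : UWOC.Modulation) :
    (∀ μ₁ μ₂ : ℝ, 0 < μ₁ → 0 < μ₂ →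
      M.avgBER P (fun o => UWOC.endSNR r₁ r₂ C μ₁ μ₂ (I₁ o) (I₂ o))
        = M.berOfCDF (UWOC.cdfOf P fun o => UWOC.endSNR r₁ r₂ C μ₁ μ₂ (I₁ o) (I₂ o))) ∧
    (∀ μ₁ μ₂ : ℝ, 0 < μ₁ → 0 < μ₂ →
      (∀ k, IntegrableOn (fun x => x ^ (M.p - 1) * Real.exp (-(M.q k * x))
        * UWOC.cdfHighSNR H₁ H₂ r₁ r₂ C μ₁ μ₂ x) (Ioi 0)) ∧
      M.berOfCDF (UWOC.cdfHighSNR H₁ H₂ r₁ r₂ C μ₁ μ₂)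
        = M.berHighSNR H₁ H₂ r₁ r₂ C μ₁ μ₂) ∧
    (∀ l : Filter (ℝ × ℝ), Tendsto Prod.fst l atTop → Tendsto Prod.snd l atTop →
      (H₁.order r₁ = H₂.order r₂ →
        (fun μ : ℝ × ℝ => Real.log μ.1) =o[l] fun μ => μ.2 ^ H₁.order r₁) →
      (1 ≤ H₂.a * H₂.c → 1 / r₂ < H₁.order r₁ →
        (fun μ : ℝ × ℝ => (μ.1 * μ.2) ^ (-(1 / r₂) : ℝ)) =o[l]
          fun μ => μ.1 ^ (-H₁.order r₁)) →
      (fun μ : ℝ × ℝ =>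
          M.avgBER P fun o => UWOC.endSNR r₁ r₂ C μ.1 μ.2 (I₁ o) (I₂ o))
        ~[l] fun μ => M.berHighSNR H₁ H₂ r₁ r₂ C μ.1 μ.2) := by
  refine ⟨fun μ₁ μ₂ hμ₁ hμ₂ => ?_, fun μ₁ μ₂ hμ₁ hμ₂ => ⟨fun k => ?_, ?_⟩,
    fun l h₁ h₂ hlog hexp => ?_⟩
  · exact M.avgBER_endSNR_eq_berOfCDF hI₁ hI₂ hC.le hμ₁.le hμ₂.le
  · exact (UWOC.integrable_gammaMeasure_iff M.p_pos (M.q_pos k) _).mp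
      (M.integrable_cdfHighSNR hr₁ hr₂ hC hμ₁ hμ₂ k)
  · exact M.berOfCDF_cdfHighSNR hr₁ hr₂ hC hμ₁ hμ₂
  · exact M.avgBER_isEquivalent_berHighSNR hI₁ hI₂ hI hr₁ hr₂ hC h₁ h₂ hlog hexp

theorem mainTheorem7
    {Ω : Type*} [MeasurableSpace Ω] (P : Measure Ω) [IsProbabilityMeasure P]
    (H₁ H₂ : UWOC.EGG) (I₁ I₂ : Ω → ℝ)
    (hI₁ : HasLaw I₁ H₁.law P) (hI₂ : HasLaw I₂ H₂.law P) (hI : IndepFun I₁ I₂ P)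
    (r₁ r₂ : ℕ) (hr₁ : r₁ = 1 ∨ r₁ = 2) (hr₂ : r₂ = 1 ∨ r₂ = 2)
    (C : ℝ) (hC : 0 < C) (M : UWOC.Modulation) :
    -- the average BER in terms of the distribution function of the end-to-end SNR
    (∀ μ₁ μ₂ : ℝ, 0 < μ₁ → 0 < μ₂ →
      M.avgBER P (fun o => UWOC.endSNR r₁ r₂ C μ₁ μ₂ (I₁ o) (I₂ o))
        = M.berOfCDF (UWOC.cdfOf P fun o => UWOC.endSNR r₁ r₂ C μ₁ μ₂ (I₁ o) (I₂ o))) ∧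
    -- the high-SNR distribution function substituted there
    (∀ μ₁ μ₂ : ℝ, 0 < μ₁ → 0 < μ₂ →
      (∀ k, IntegrableOn (fun x => x ^ (M.p - 1) * Real.exp (-(M.q k * x))
        * UWOC.cdfHighSNR H₁ H₂ r₁ r₂ C μ₁ μ₂ x) (Ioi 0)) ∧
      M.berOfCDF (UWOC.cdfHighSNR H₁ H₂ r₁ r₂ C μ₁ μ₂)
        = M.berHighSNR H₁ H₂ r₁ r₂ C μ₁ μ₂) ∧
    -- the average BER is asymptotic to the resulting sum as both average electrical SNRs grow
    (∀ l : Filter (ℝ × ℝ), Tendsto Prod.fst l atTop → Tendsto Prod.snd l atTop →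
      (H₁.order r₁ = H₂.order r₂ →
        (fun μ : ℝ × ℝ => Real.log μ.1) =o[l] fun μ => μ.2 ^ H₁.order r₁) →
      (1 ≤ H₂.a * H₂.c → 1 / r₂ < H₁.order r₁ →
        (fun μ : ℝ × ℝ => (μ.1 * μ.2) ^ (-(1 / r₂) : ℝ)) =o[l]
          fun μ => μ.1 ^ (-H₁.order r₁)) →
      (fun μ : ℝ × ℝ =>
          M.avgBER P fun o => UWOC.endSNR r₁ r₂ C μ.1 μ.2 (I₁ o) (I₂ o))
        ~[l] fun μ => M.berHighSNR H₁ H₂ r₁ r₂ C μ.1 μ.2) := by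
  exact mainTheorem7_general P H₁ H₂ I₁ I₂ hI₁ hI₂ hI r₁ r₂ (by omega) (by omega) C hC M
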